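/- Let $q=p^m$ with $p$ prime, let $\mathbb{F}_q$ be the field with $q$ elements, and for $k\in\{3,4\}$ let $R_k=\{x^k : x\in\mathbb{F}_q^*\}$. Let $\Gamma(k,q)$ be the generalized Paley graph, with vertex set $\mathbb{F}_q$ and an arrow from $v$ to $w$ iff $w-v\in R_k$, and let $\Gamma^+(k,q)$ be the generalized Paley sum graph, with vertex set $\mathbb{F}_q$ and an arrow from $v$ to $w$ iff $v+w\in R_k$ (loops allowed). Write $\Gamma^*(k,q)$ for either of the two. The energy $E(\Gamma)$ of a finite graph is the sum of the absolute values of the eigenvalues of its adjacency matrix, counted with multiplicity. Assume $k\mid\frac{q-1}{p-1}$ and put $n=\frac{q-1}{k}$. (a) Suppose $p\equiv 1\pmod k$. If $k=3$, there are integers $a,b$ with $4\sqrt[3]{q}=a^2+27b^2$, $a\equiv 1\pmod 3$ and $(a,p)=1$, and for all such $a,b$ $$n\Big(1+\tfrac13\big|2a\sqrt[3]{q}+1\big|\Big)\le E(\Gamma^*(3,q))\le n\Big(1+\tfrac23\big(|a|\sqrt[3]{q}+1\big)+3|b|\sqrt[3]{q}\Big).$$ If $k=4$, there are integers $c,d$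 with $\sqrt{q}=c^2+4d^2$, $c\equiv 1\pmod 4$ and $(c,p)=1$, and for all such $c,d$ $$n\big(\sqrt{q}+1\big)\le E(\Gamma^*(4,q))\le n\Big(\sqrt{q}+1+\big(|c|+2|d|\big)\sqrt[4]{q}\Big).$$ (b) Suppose $p\equiv -1\pmod k$. Then $m$ is even, and: (i) if $k=3$ (so $p\equiv 2\pmod 3$), then $E(\Gamma^*(3,q))=2n\,\frac{2\sqrt{q}+1}{3}$ if $m\equiv 0\pmod 4$, and $E(\Gamma^*(3,q))=4n\,\frac{\sqrt{q}+1}{3}$ if $m\equiv 2\pmod 4$; (ii) if $k=4$ (so $p\equiv 3\pmod 4$), then $E(\Gamma^*(4,q))=n\,\frac{3\sqrt{q}+1}{2}$ if $m\equiv 0\pmod 4$, and $E(\Gamma^*(4,q))=3n\,\frac{\sqrt{q}+1}{2}$ if $m\equiv 2\pmod 4$. -/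

import Mathlib

/-- The Cayley (di)graph `X(G, S)`: an arrow from `v` to `w` whenever `w - v ∈ S`. -/
def cayleyGraph {G : Type*} [AddCommGroup G] (S : Set G) : Digraph G where
  Adj v w := w - v ∈ S

/-- The Cayley sum (di)graph `X⁺(G, S)`: an arrow from `v` to `w` whenever `v + w ∈ S`
(loops are allowed). -/
def cayleySumGraph {G : Type*} [AddCommGroup G] (S : Set G) : Digraph G where
  Adj v w := v + w ∈ S

/-- The set `R_k` of nonzero `k`-th powers of a field. -/
def nonzeroPowers (k : ℕ) (F : Type*) [Field F] : Set F :=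
  {y | ∃ x : F, x ≠ 0 ∧ x ^ k = y}

/-- The generalized Paley graph `Γ(k, q)`, where `F` is the field with `q` elements. -/
def gpGraph (k : ℕ) (F : Type*) [Field F] : Digraph F :=
  cayleyGraph (nonzeroPowers k F)

/-- The generalized Paley sum graph `Γ⁺(k, q)`, where `F` is the field with `q` elements. -/
def gpSumGraph (k : ℕ) (F : Type*) [Field F] : Digraph F :=
  cayleySumGraph (nonzeroPowers k F)

open Classical in
/-- The adjacency matrix of a digraph, with complex entries. -/
noncomputable def digraphAdjMatrix {V : Type*} (Γ : Digraph V) : Matrix V V ℂ :=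
  Matrix.of fun v w => if Γ.Adj v w then 1 else 0

open Classical in
/-- The energy of a finite digraph: the sum of `|λ|` over the eigenvalues `λ` of its adjacency
matrix, counted with (algebraic) multiplicity. -/
noncomputable def graphEnergy {V : Type*} [Fintype V] (Γ : Digraph V) : ℝ :=
  ((digraphAdjMatrix Γ).charpoly.roots.map (fun z : ℂ => ‖z‖)).sum

/-- The conditions `4 ∛q = a² + 27 b²`, `a ≡ 1 (mod 3)`, `(a, p) = 1`. -/
def IsCubicPair (p q : ℕ) (a b : ℤ) : Prop :=
  4 * (q : ℝ) ^ (1 / 3 : ℝ) = (a : ℝ) ^ 2 + 27 * (b : ℝ) ^ 2 ∧ a ≡ 1 [ZMOD 3] ∧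
    IsCoprime a (p : ℤ)

/-- The conditions `√q = c² + 4 d²`, `c ≡ 1 (mod 4)`, `(c, p) = 1`. -/
def IsQuarticPair (p q : ℕ) (c d : ℤ) : Prop :=
  √(q : ℝ) = (c : ℝ) ^ 2 + 4 * (d : ℝ) ^ 2 ∧ c ≡ 1 [ZMOD 4] ∧ IsCoprime c (p : ℤ)

/-! The additive characters diagonalize a Cayley graph on `F`, so the eigenvalues of Γ(k,q) are n at
the trivial character and the Gaussian periods η at the others. A period depends only on the coset
of its argument modulo k-th powers, so the energy is n + n(|η_0| + ... + |η_{k-1}|). The hypothesis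
on k places the nonzero elements of the prime field inside R_k. Hence -1 ∈ R_k, and the sum graph
has the same squared adjacency matrix, so the same energy. It also makes every period a rational
algebraic integer, hence an integer.

Put c = χ(g)⁻¹ for a character χ of order k and a generator g. Then kη_j + 1 is the sum of c^{ij}
G(χ^i) over 0 < i < k. With G(χ)G(χ⁻¹) = q this yields integer equations. For k = 3, the numbers x_j
= 3η_j + 1 have sum 0 and sum of squares 6q. For k = 4, the shifted periods are x ± 2A and -x ± 2B
with x² = q = A² + B².

If p ≡ 1 (mod k), then k ∣ m. The relation between Gauss and Jacobi sums shows that G(χ) divided by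
the k-th root of q is an algebraic integer, so that root divides every x_j (resp. A and B). The
quotients are prime to p: modulo p, the trace of the Jacobi sum is, up to sign, a binomial
coefficient that Lucas' theorem shows to be nonzero. The quotients give one representation by a² +
27b² or c² + 4d², and `sq_eq_sq_of_sq_add_mul_sq_eq` shows that there is no other up to signs. The
bounds then follow from the triangle inequality.

If p ≡ -1 (mod k), the relevant quadratic form (y² + yz + z² or y² + z²) is anisotropic modulo p. By
descent a representation of p^(2s) is p^s times a representation of 1, so congruences modulo k
determine the multiset of periods, and the energy is exact. -/

/-! ### Spectra of Cayley graphs and Cayley sum graphs -/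

open Finset Polynomial in
/-- If two complex matrices have the same square, the absolute values of their eigenvalues have
the same sum. -/
theorem sum_norm_roots_charpoly_eq_of_sq_eq {V : Type*} [Fintype V] [DecidableEq V]
    {A B : Matrix V V ℂ} (h : A * A = B * B) :
    (A.charpoly.roots.map (fun z : ℂ => ‖z‖)).sum =
      (B.charpoly.roots.map (fun z : ℂ => ‖z‖)).sum := by
  have eval_prod : ∀ (M : Matrix V V ℂ) (t : ℂ),
      M.charpoly.eval t = (M.charpoly.roots.map (fun z => t - z)).prod := by
    intro M t
    have := (IsAlgClosed.splits M.charpoly).eq_prod_roots_of_monic M.charpoly_monic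
    conv_lhs => rw [this]
    rw [Polynomial.eval_multiset_prod, Multiset.map_map]
    simp
  have key : ∀ (M : Matrix V V ℂ),
      (M * M).charpoly.roots = M.charpoly.roots.map (fun z => z ^ 2) := by
    intro M
    have hp : (M * M).charpoly = ((M.charpoly.roots.map (fun z => z ^ 2)).map
        (fun a => X - C a)).prod := by
      refine Polynomial.funext fun s => ?_
      -- Every complex number is a square t², and t² - M² = (t - M)(t + M).
      obtain ⟨t, ht⟩ := IsAlgClosed.exists_pow_nat_eq s (n := 2) (by norm_num)
      have h1 : (M * M).charpoly.eval s =
          (Matrix.scalar V t - M).det * (Matrix.scalar V t + M).det := by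
        rw [Matrix.eval_charpoly, ← Matrix.det_mul, ← ht]
        congr 1
        have hc : Matrix.scalar V t * M = M * Matrix.scalar V t :=
          (Matrix.scalar_commute t (fun r => Commute.all _ _) M).eq
        rw [sub_mul, mul_add, mul_add, hc, pow_two, map_mul]
        abel
      have h2 : (Matrix.scalar V t + M).det =
          (M.charpoly.roots.map (fun z => t + z)).prod := by
        have h3 : Matrix.scalar V t + M = -(Matrix.scalar V (-t) - M) := by
          rw [map_neg]; abel
        rw [h3, Matrix.det_neg, ← Matrix.eval_charpoly, eval_prod]
        have h4 : Multiset.card M.charpoly.roots = Fintype.card V := by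
          rw [← (IsAlgClosed.splits M.charpoly).natDegree_eq_card_roots,
            Matrix.charpoly_natDegree_eq_dim]
        rw [← h4, ← Multiset.prod_replicate, ← Multiset.map_const', ← Multiset.prod_map_mul]
        congr 1
        refine Multiset.map_congr rfl fun z _ => ?_
        ring
      rw [h1, h2, ← Matrix.eval_charpoly, eval_prod, ← Multiset.prod_map_mul,
        Polynomial.eval_multiset_prod, Multiset.map_map, Multiset.map_map]
      congr 1
      refine Multiset.map_congr rfl fun z _ => ?_
      simp [← ht]; ring
    rw [hp, Polynomial.roots_multiset_prod_X_sub_C]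
  have norm_sum : ∀ (M : Matrix V V ℂ), (M.charpoly.roots.map (fun z : ℂ => ‖z‖)).sum =
      ((M * M).charpoly.roots.map (fun z : ℂ => √‖z‖)).sum := by
    intro M
    rw [key, Multiset.map_map]
    congr 1
    refine Multiset.map_congr rfl fun z _ => ?_
    simp
  rw [norm_sum A, norm_sum B, h]

open Finset Polynomial in
/-- The energy of a Cayley graph on the additive group of a finite field is the sum of the absolute
values of the character sums over the connection set. -/
theorem graphEnergy_cayleyGraph {F : Type*} [Field F] [Fintype F] (S : Set F)
    {ψ : AddChar F ℂ} (hψ : ψ.IsPrimitive) :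
    graphEnergy (cayleyGraph S) = ∑ b : F, ‖∑ y : F, S.indicator (fun y => ψ (b * y)) y‖ := by
  classical
  set e : F → ℂ := fun b => ∑ y : F, S.indicator (fun y => ψ (b * y)) y with he
  set A := digraphAdjMatrix (cayleyGraph S) with hA
  let V : Matrix F F ℂ := Matrix.of fun v b => ψ (b * v)
  let W : Matrix F F ℂ := Matrix.of fun b v => (Fintype.card F : ℂ)⁻¹ * ψ (-(b * v))
  have hq : (Fintype.card F : ℂ) ≠ 0 := by simp
  have hVW : V * W = 1 := by
    ext v w
    simp only [Matrix.mul_apply, V, W, Matrix.of_apply, Matrix.one_apply]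
    have : ∀ b : F, ψ (b * v) * ((Fintype.card F : ℂ)⁻¹ * ψ (-(b * w))) =
        (Fintype.card F : ℂ)⁻¹ * ψ (b * (v - w)) := by
      intro b
      rw [mul_left_comm, ← AddChar.map_add_eq_mul]
      congr 2; ring
    simp_rw [this, ← Finset.mul_sum, AddChar.sum_mulShift _ hψ, sub_eq_zero]
    split_ifs <;> simp [hq]
  have hAV : A * V = V * Matrix.diagonal e := by
    ext v b
    rw [Matrix.mul_diagonal, Matrix.mul_apply]
    simp only [A, V, digraphAdjMatrix, cayleyGraph, Matrix.of_apply, he]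
    rw [← Equiv.sum_comp (Equiv.addRight v), Finset.mul_sum]
    refine Finset.sum_congr rfl fun y _ => ?_
    simp only [Equiv.coe_addRight, add_sub_cancel_right, Set.indicator_apply]
    split_ifs
    · rw [one_mul, ← AddChar.map_add_eq_mul]; congr 1; ring
    · simp
  have hWV : W * V = 1 := mul_eq_one_comm.mp hVW
  have hAD : A = V * Matrix.diagonal e * W := by
    rw [← hAV, Matrix.mul_assoc, hVW, Matrix.mul_one]
  have hchar : A.charpoly = ∏ b, (X - C (e b)) := by
    rw [hAD, ← Matrix.charpoly_diagonal, Matrix.charpoly_mul_comm, ← Matrix.mul_assoc, hWV,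
      Matrix.one_mul]
  unfold graphEnergy
  have hdec : (A.charpoly.roots.map (fun z : ℂ => ‖z‖)).sum = ∑ b : F, ‖e b‖ := by
    rw [hchar, Finset.prod_eq_multiset_prod, show (fun b => X - C (e b)) = (fun a => X - C a) ∘ e from rfl,
      ← Multiset.map_map, Polynomial.roots_multiset_prod_X_sub_C, Multiset.map_map]
    rfl
  convert hdec using 1

open Finset in
/-- A Cayley graph with symmetric connection set and the corresponding Cayley sum graph have the
same energy. -/
theorem graphEnergy_cayleySumGraph {G : Type*} [AddCommGroup G] [Fintype G] {S : Set G}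
    (hS : ∀ x, -x ∈ S ↔ x ∈ S) :
    graphEnergy (cayleySumGraph S) = graphEnergy (cayleyGraph S) := by
  classical
  unfold graphEnergy
  convert sum_norm_roots_charpoly_eq_of_sq_eq (A := digraphAdjMatrix (cayleySumGraph S))
    (B := digraphAdjMatrix (cayleyGraph S)) ?_ using 1
  ext v w
  -- Replacing the middle vertex u by -u in the sum graph turns the two arrow conditions into v - u
  -- ∈ S and w - u ∈ S; symmetry of S does the rest.
  rw [Matrix.mul_apply, Matrix.mul_apply, ← Equiv.sum_comp (Equiv.neg G)]
  refine Finset.sum_congr rfl fun u _ => ?_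
  simp only [digraphAdjMatrix, cayleySumGraph, cayleyGraph, Matrix.of_apply, Equiv.neg_apply]
  have h1 : v + -u ∈ S ↔ u - v ∈ S := by rw [← hS, neg_add_rev, neg_neg, sub_eq_add_neg]
  have h2 : -u + w ∈ S ↔ w - u ∈ S := by rw [neg_add_eq_sub]
  by_cases h3 : u - v ∈ S <;> by_cases h4 : w - u ∈ S <;> simp [h1, h2, h3, h4]

/-! ### Gaussian periods and their integrality -/

/-- A rational algebraic integer is an integer. -/
theorem exists_int_eq_of_isIntegral_of_mul_eq {x : ℂ} (hx : IsIntegral ℤ x) {a b : ℤ} (ha : a ≠ 0)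
    (h : (a : ℂ) * x = b) : ∃ c : ℤ, x = c := by
  have hac : (a : ℂ) ≠ 0 := by exact_mod_cast ha
  have hxe : x = algebraMap ℚ ℂ ((b : ℚ) / a) := by
    simp only [map_div₀, map_intCast]
    field_simp
    linear_combination h
  rw [hxe, isIntegral_algebraMap_iff (algebraMap ℚ ℂ).injective] at hx
  obtain ⟨c, hc⟩ := IsIntegrallyClosed.isIntegral_iff.mp hx
  exact ⟨c, by rw [hxe, ← hc]; simp⟩

/-- The Gaussian period: the sum of an additive character over a coset of the `k`-th powers. -/
noncomputable def gaussianPeriod {F : Type*} [Field F] [Fintype F] (ψ : AddChar F ℂ) (k : ℕ)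
    (b : F) : ℂ :=
  ∑ y : F, (nonzeroPowers k F).indicator (fun y => ψ (b * y)) y

section Powers

variable {F : Type*} [Field F] {k n : ℕ}

theorem zero_notMem_nonzeroPowers : (0 : F) ∉ nonzeroPowers k F := by
  rintro ⟨y, hy, h⟩
  exact hy (eq_zero_of_pow_eq_zero h)

theorem isPrimitiveRoot_mulChar_generator {g : Fˣ} (hg : ∀ x, x ∈ Subgroup.zpowers g)
    {χ : MulChar F ℂ} (hχ : orderOf χ = k) : IsPrimitiveRoot (χ g) k := by
  rw [IsPrimitiveRoot.iff_def]
  have key : ∀ j : ℕ, χ g ^ j = 1 ↔ χ ^ j = 1 := by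
    intro j
    rw [← MulChar.pow_apply_coe, MulChar.eq_iff hg, MulChar.one_apply_coe]
  refine ⟨(key k).mpr (hχ ▸ pow_orderOf_eq_one χ), fun l hl => ?_⟩
  rw [← hχ]
  exact orderOf_dvd_of_pow_eq_one ((key l).mp hl)

theorem mulChar_pow_eq_one (hk : k ≠ 0) {χ : MulChar F ℂ} (hχ : orderOf χ = k) {x : F}
    (hx : x ≠ 0) : χ x ^ k = 1 := by
  rw [← MulChar.pow_apply' χ hk, ← hχ, pow_orderOf_eq_one, MulChar.one_apply (Ne.isUnit hx)]

variable [Fintype F]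

theorem orderOf_generator {g : Fˣ} (hg : ∀ x, x ∈ Subgroup.zpowers g)
    (hkn : Fintype.card F = k * n + 1) : orderOf g = k * n := by
  classical
  rw [orderOf_eq_card_of_forall_mem_zpowers hg, Nat.card_eq_fintype_card, Fintype.card_units, hkn]
  rfl

theorem generator_pow_pow_eq_one_iff {g : Fˣ} (hg : ∀ x, x ∈ Subgroup.zpowers g)
    (hkn : Fintype.card F = k * n + 1) (hn : 0 < n) (j : ℕ) :
    (((g ^ j : Fˣ) : F)) ^ n = 1 ↔ k ∣ j := by
  rw [← Units.val_pow_eq_pow_val, Units.val_eq_one, ← pow_mul, ← orderOf_dvd_iff_pow_eq_one,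
    orderOf_generator hg hkn]
  exact Nat.mul_dvd_mul_iff_right hn

theorem exists_generator_pow_eq {g : Fˣ} (hg : ∀ x, x ∈ Subgroup.zpowers g) {x : F} (hx : x ≠ 0) :
    ∃ j : ℕ, x = ((g ^ j : Fˣ) : F) := by
  obtain ⟨j, hj⟩ := (mem_powers_iff_mem_zpowers.mpr (hg (Units.mk0 x hx)))
  exact ⟨j, by simp only at hj; rw [hj]; rfl⟩

theorem mem_nonzeroPowers_iff (hkn : Fintype.card F = k * n + 1) (hn : 0 < n)
    {x : F} (hx : x ≠ 0) : x ∈ nonzeroPowers k F ↔ x ^ n = 1 := by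
  constructor
  · rintro ⟨y, hy, rfl⟩
    rw [← pow_mul]
    have := FiniteField.pow_card_sub_one_eq_one y hy
    rwa [hkn, Nat.add_sub_cancel] at this
  · intro h
    obtain ⟨g, hg⟩ := IsCyclic.exists_generator (α := Fˣ)
    obtain ⟨j, rfl⟩ := exists_generator_pow_eq hg hx
    rw [generator_pow_pow_eq_one_iff hg hkn hn] at h
    obtain ⟨i, rfl⟩ := h
    exact ⟨((g ^ i : Fˣ) : F), Units.ne_zero _, by
      rw [← Units.val_pow_eq_pow_val, ← pow_mul, mul_comm]⟩

theorem mulChar_eq_one_iff (hkn : Fintype.card F = k * n + 1) (hn : 0 < n) {χ : MulChar F ℂ}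
    (hχ : orderOf χ = k) {x : F} (hx : x ≠ 0) : χ x = 1 ↔ x ^ n = 1 := by
  obtain ⟨g, hg⟩ := IsCyclic.exists_generator (α := Fˣ)
  obtain ⟨j, rfl⟩ := exists_generator_pow_eq hg hx
  rw [generator_pow_pow_eq_one_iff hg hkn hn, Units.val_pow_eq_pow_val, map_pow,
    (isPrimitiveRoot_mulChar_generator hg hχ).pow_eq_one_iff_dvd]

/-- Detecting `k`-th powers with the powers of a character of order `k`. -/
theorem sum_mulChar_pow_mul (hk : k ≠ 0) (hkn : Fintype.card F = k * n + 1) (hn : 0 < n)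
    {χ : MulChar F ℂ} (hχ : orderOf χ = k) (f : F → ℂ) (y : F) :
    ∑ i ∈ Finset.range k, (χ ^ i) y * f y = k * (nonzeroPowers k F).indicator f y := by
  classical
  by_cases hy : y = 0
  · subst hy
    rw [Set.indicator_of_notMem zero_notMem_nonzeroPowers, mul_zero]
    exact Finset.sum_eq_zero fun i _ => by rw [MulChar.map_zero, zero_mul]
  · have h1 : ∀ i, (χ ^ i) y = χ y ^ i := fun i => by
      simpa using MulChar.pow_apply_coe χ i (Units.mk0 y hy)
    simp_rw [h1, ← Finset.sum_mul]
    rw [Set.indicator_apply, mem_nonzeroPowers_iff hkn hn hy, ← mulChar_eq_one_iff hkn hn hχ hy]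
    split_ifs with h
    · simp [h]
    · have h2 : (∑ i ∈ Finset.range k, χ y ^ i) * (χ y - 1) = 0 := by
        rw [geom_sum_mul, mulChar_pow_eq_one hk hχ hy, sub_self]
      rw [(mul_eq_zero.mp h2).resolve_right (sub_ne_zero.mpr h), zero_mul, mul_zero]

/-- The Gaussian period at zero is the number of `k`-th powers. -/
theorem gaussianPeriod_zero (hk : k ≠ 0) (hkn : Fintype.card F = k * n + 1) (hn : 0 < n)
    (ψ : AddChar F ℂ) {χ : MulChar F ℂ} (hχ : orderOf χ = k) : gaussianPeriod ψ k 0 = n := by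
  classical
  have hk' : (k : ℂ) ≠ 0 := by exact_mod_cast hk
  refine mul_left_cancel₀ hk' ?_
  rw [gaussianPeriod, Finset.mul_sum]
  simp_rw [← sum_mulChar_pow_mul hk hkn hn hχ]
  rw [Finset.sum_comm]
  simp only [zero_mul, AddChar.map_zero_eq_one, mul_one]
  rw [Finset.sum_eq_single_of_mem 0 (by simp; omega)]
  · rw [pow_zero, MulChar.sum_one_eq_card_units, Fintype.card_units, hkn]; simp
  · intro i hi h0
    refine MulChar.sum_eq_zero_of_ne_one fun h => ?_
    have := orderOf_dvd_of_pow_eq_one h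
    rw [hχ] at this
    exact absurd (Nat.le_of_dvd (by omega) this) (by simpa using hi)

/-- The Gaussian periods as combinations of Gauss sums. -/
theorem mul_gaussianPeriod (hk : k ≠ 0) (hkn : Fintype.card F = k * n + 1) (hn : 0 < n)
    {ψ : AddChar F ℂ} (hψ : ψ ≠ 1) {χ : MulChar F ℂ} (hχ : orderOf χ = k) (b : Fˣ) :
    k * gaussianPeriod ψ k b + 1 =
      ∑ i ∈ Finset.Ico 1 k, ((χ b)⁻¹) ^ i * gaussSum (χ ^ i) ψ := by
  have h0 : ∀ i, ∑ y : F, (χ ^ i) y * ψ (b * y) = ((χ b)⁻¹) ^ i * gaussSum (χ ^ i) ψ := by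
    intro i
    have h1 := gaussSum_mulShift (χ ^ i) ψ b
    rw [MulChar.pow_apply_coe] at h1
    have h2 : χ b ≠ 0 := MulChar.apply_ne_zero_iff.mpr b.isUnit
    rw [← h1, ← mul_assoc, ← mul_pow, inv_mul_cancel₀ h2, one_pow, one_mul]
    rfl
  rw [gaussianPeriod, Finset.mul_sum]
  simp_rw [← sum_mulChar_pow_mul hk hkn hn hχ]
  rw [Finset.sum_comm]
  simp_rw [h0]
  rw [Finset.range_eq_Ico, Finset.sum_eq_sum_Ico_succ_bot (by omega)]
  simp [gaussSum_one_left hψ]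

/-- Multiplication by a nonzero k-th power permutes the k-th powers. -/
theorem gaussianPeriod_mul (ψ : AddChar F ℂ) (b : F) {c : F} (hc : c ∈ nonzeroPowers k F) :
    gaussianPeriod ψ k (b * c) = gaussianPeriod ψ k b := by
  classical
  obtain ⟨u, hu, rfl⟩ := hc
  have huk : u ^ k ≠ 0 := pow_ne_zero _ hu
  unfold gaussianPeriod
  rw [← Equiv.sum_comp (Equiv.mulLeft₀ (u ^ k) huk)
    (fun y => (nonzeroPowers k F).indicator (fun y => ψ (b * y)) y)]
  refine Finset.sum_congr rfl fun y _ => ?_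
  have : u ^ k * y ∈ nonzeroPowers k F ↔ y ∈ nonzeroPowers k F := by
    constructor
    · rintro ⟨v, hv, h⟩
      exact ⟨v / u, div_ne_zero hv hu, by rw [div_pow, h]; field_simp⟩
    · rintro ⟨v, hv, rfl⟩
      exact ⟨u * v, mul_ne_zero hu hv, mul_pow _ _ _⟩
  simp only [Equiv.mulLeft₀_apply, Set.indicator_apply, this, mul_assoc]

/-- The subgroup generated by g^k has k cosets, each with n elements, represented by the first k
powers of g. -/
theorem sum_units_eq_of_periodic [Fintype Fˣ] {M : Type*} [AddCommMonoid M] {g : Fˣ}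
    (hg : ∀ x, x ∈ Subgroup.zpowers g) (hkn : Fintype.card F = k * n + 1) (f : Fˣ → M)
    (hf : ∀ b, f (b * g ^ k) = f b) :
    ∑ b : Fˣ, f b = n • ∑ j ∈ Finset.range k, f (g ^ j) := by
  classical
  have hc : Nat.card Fˣ = k * n := by
    rw [← orderOf_eq_card_of_forall_mem_zpowers hg, orderOf_generator hg hkn]
  have h1 : ∑ b : Fˣ, f b = ∑ j ∈ Finset.range (k * n), f (g ^ j) := by
    rw [← IsCyclic.image_range_card hg, Finset.sum_image, hc]
    intro i hi j hj hij
    rw [hc, ← orderOf_generator hg hkn] at hi hj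
    exact pow_injOn_Iio_orderOf (by simpa using hi) (by simpa using hj) hij
  have h2 : ∀ l j, f (g ^ (k * l + j)) = f (g ^ j) := by
    intro l
    induction l with
    | zero => simp
    | succ l ih =>
      intro j
      rw [← ih j, ← hf (g ^ (k * l + j)), ← pow_add]
      congr 2; ring
  rw [h1]
  clear h1 hkn hc
  induction n with
  | zero => simp
  | succ l ih => rw [Nat.mul_succ, Finset.sum_range_add, ih, succ_nsmul]; simp_rw [h2]

/-- The energy of the generalized Paley graph in terms of Gaussian periods. -/
theorem graphEnergy_gpGraph (hk : k ≠ 0) (hkn : Fintype.card F = k * n + 1) (hn : 0 < n)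
    {ψ : AddChar F ℂ} (hψ : ψ.IsPrimitive) {χ : MulChar F ℂ} (hχ : orderOf χ = k) {g : Fˣ}
    (hg : ∀ x, x ∈ Subgroup.zpowers g) :
    graphEnergy (gpGraph k F) =
      n + n * ∑ j ∈ Finset.range k, ‖gaussianPeriod ψ k ((g ^ j : Fˣ) : F)‖ := by
  classical
  rw [gpGraph, graphEnergy_cayleyGraph _ hψ]
  change ∑ b, ‖gaussianPeriod ψ k b‖ = _
  rw [Fintype.sum_eq_add_sum_compl 0, gaussianPeriod_zero hk hkn hn ψ hχ]
  have h1 : ∑ b ∈ ({0}ᶜ : Finset F), ‖gaussianPeriod ψ k b‖ =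
      ∑ b : Fˣ, ‖gaussianPeriod ψ k (b : F)‖ := by
    symm
    refine Finset.sum_bij (fun b _ => (b : F)) (by simp)
      (fun _ _ _ _ h => Units.ext h) ?_ (fun _ _ => rfl)
    intro b hb
    exact ⟨Units.mk0 b (by simpa using hb), by simp, rfl⟩
  rw [h1, sum_units_eq_of_periodic hg hkn]
  · simp
  · intro b
    rw [Units.val_mul, gaussianPeriod_mul]
    exact ⟨g, g.ne_zero, by simp⟩

theorem isIntegral_addChar (ψ : AddChar F ℂ) (x : F) : IsIntegral ℤ (ψ x) := by
  refine IsIntegral.of_pow (n := Fintype.card F) Fintype.card_pos ?_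
  rw [← AddChar.map_nsmul_eq_pow]
  simp [isIntegral_one]

theorem isIntegral_gaussianPeriod (ψ : AddChar F ℂ) (b : F) :
    IsIntegral ℤ (gaussianPeriod ψ k b) := by
  classical
  refine IsIntegral.sum _ fun y _ => ?_
  rw [Set.indicator_apply]
  split_ifs
  · exact isIntegral_addChar _ _
  · exact isIntegral_zero

/-- When the prime field consists of `k`-th powers, the Gaussian periods are integers. -/
theorem exists_int_eq_gaussianPeriod {p : ℕ} [hp : Fact p.Prime] [CharP F p] (hk : k ≠ 0)
    (hkn : Fintype.card F = k * n + 1) (hn : 0 < n) (hpn : p - 1 ∣ n) (ψ : AddChar F ℂ)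
    {χ : MulChar F ℂ} (hχ : orderOf χ = k) (b : F) : ∃ z : ℤ, gaussianPeriod ψ k b = z := by
  classical
  let _ := ZMod.algebra F p
  -- A nonzero t of the prime field satisfies t^n = 1, because p - 1 ∣ n; it is thus a k-th power
  -- and leaves the period unchanged.
  have h1 : ∑ t : ZMod p, gaussianPeriod ψ k (b * algebraMap (ZMod p) F t) =
      n + (p - 1 : ℕ) * gaussianPeriod ψ k b := by
    rw [Fintype.sum_eq_add_sum_compl 0, map_zero, mul_zero, gaussianPeriod_zero hk hkn hn ψ hχ]
    congr 1
    rw [Finset.sum_congr rfl (g := fun _ => gaussianPeriod ψ k b)]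
    · rw [Finset.sum_const, Finset.card_compl, ZMod.card]; simp
    · intro t ht
      have ht0 : t ≠ 0 := by simpa using ht
      apply gaussianPeriod_mul
      rw [mem_nonzeroPowers_iff hkn hn (by simpa using ht0), ← map_pow]
      obtain ⟨c, rfl⟩ := hpn
      rw [pow_mul, ZMod.pow_card_sub_one_eq_one ht0, one_pow, map_one]
  -- Summed over t first, each term is a complete sum of an additive character of `ZMod p`, so it is
  -- p or 0.
  have h2 : ∃ z : ℤ, ∑ t : ZMod p, gaussianPeriod ψ k (b * algebraMap (ZMod p) F t) = z := by
    have : ∀ y : F, ∃ z : ℤ, ∑ t : ZMod p, (nonzeroPowers k F).indicator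
        (fun y => ψ (b * algebraMap (ZMod p) F t * y)) y = z := by
      intro y
      by_cases hy : y ∈ nonzeroPowers k F
      · simp_rw [Set.indicator_of_mem hy]
        have h3 := AddChar.sum_eq_ite (ψ.compAddMonoidHom
          ((AddMonoidHom.mulLeft (b * y)).comp (algebraMap (ZMod p) F).toAddMonoidHom))
        rw [Finset.sum_congr rfl (g := fun t => ψ.compAddMonoidHom
          ((AddMonoidHom.mulLeft (b * y)).comp (algebraMap (ZMod p) F).toAddMonoidHom) t), h3]
        · split_ifs
          · exact ⟨Fintype.card (ZMod p), by simp⟩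
          · exact ⟨0, by simp⟩
        · intro t _
          simp only [AddChar.compAddMonoidHom_apply, AddMonoidHom.comp_apply]
          congr 1
          simp; ring
      · exact ⟨0, by simp [Set.indicator_of_notMem hy]⟩
    choose z hz using this
    refine ⟨∑ y, z y, ?_⟩
    unfold gaussianPeriod
    rw [Finset.sum_comm]
    simp [hz]
  obtain ⟨z, hz⟩ := h2
  refine exists_int_eq_of_isIntegral_of_mul_eq (isIntegral_gaussianPeriod ψ b)
    (a := (p - 1 : ℕ)) (b := z - n) ?_ ?_
  · have := hp.out.two_le
    omega
  · rw [Int.cast_sub, ← hz, h1]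
    push_cast
    ring

end Powers

/-! ### Jacobi sums modulo p -/

/-- By Lucas' theorem, the binomial coefficient `((k - 1) n choose n)` with `k n + 1 = p ^ m` is not
divisible by `p` if `p ≡ 1 (mod k)`. -/
theorem not_dvd_choose_of_mul_add_one_eq_pow {p k d : ℕ} (hp : p.Prime) (hpd : p = k * d + 1)
    (hk : 2 ≤ k) {m n : ℕ} (hn : k * n + 1 = p ^ m) : ¬ p ∣ ((k - 1) * n).choose n := by
  have := Fact.mk hp
  obtain ⟨k, rfl⟩ := Nat.exists_eq_succ_of_ne_zero (show k ≠ 0 by omega)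
  simp only [Nat.succ_eq_add_one, Nat.add_sub_cancel] at *
  induction m generalizing n with
  | zero =>
    have : n = 0 := by
      rw [pow_zero] at hn
      have : (k + 1) * n = 0 := by omega
      simpa using this
    subst this
    simpa using hp.one_lt.ne'
  | succ m ih =>
    obtain ⟨l, hl⟩ : ∃ l, (k + 1) * l + 1 = p ^ m := by
      have h1 : p ^ m ≡ 1 [MOD (k + 1)] := by
        have : p ≡ 1 [MOD (k + 1)] := by
          rw [hpd]; exact (Nat.modEq_iff_dvd' (by omega)).mpr (by simp) |>.symm
        simpa using this.pow m
      obtain ⟨l, hl⟩ := (Nat.modEq_iff_dvd' (Nat.pos_of_ne_zero (pow_ne_zero _ hp.ne_zero))).mp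
        h1.symm
      exact ⟨l, by rw [← hl]; exact Nat.sub_add_cancel (Nat.pos_of_ne_zero (pow_ne_zero _ hp.ne_zero))⟩
    -- The lowest base-p digit of n is d, and that of k * n is k * d < p (k here is the original k
    -- minus 1). Lucas strips this digit and leaves the same problem for l.
    have hnl : n = l * p + d := by
      have : (k + 1) * n = (k + 1) * (l * p + d) := by
        have h2 : (k + 1) * n + 1 = ((k + 1) * l + 1) * p := by rw [hn, hl, pow_succ]
        nlinarith
      exact Nat.eq_of_mul_eq_mul_left (by omega) this
    have hd : d < p := by rw [hpd]; nlinarith [Nat.zero_le (k * d)]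
    have hkd : k * d < p := by rw [hpd]; nlinarith
    have hp0 : 0 < p := hp.pos
    have e1 : (k * n) % p = k * d := by
      rw [hnl, show k * (l * p + d) = k * d + p * (k * l) by ring, Nat.add_mul_mod_self_left,
        Nat.mod_eq_of_lt hkd]
    have e2 : (k * n) / p = k * l := by
      rw [hnl, show k * (l * p + d) = k * d + p * (k * l) by ring, Nat.add_mul_div_left _ _ hp0,
        Nat.div_eq_of_lt hkd, zero_add]
    have e3 : n % p = d := by
      rw [hnl, show l * p + d = d + p * l by ring, Nat.add_mul_mod_self_left, Nat.mod_eq_of_lt hd]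
    have e4 : n / p = l := by
      rw [hnl, show l * p + d = d + p * l by ring, Nat.add_mul_div_left _ _ hp0,
        Nat.div_eq_of_lt hd, zero_add]
    have := Choose.choose_modEq_choose_mod_mul_choose_div_nat (n := k * n) (k := n) (p := p)
    rw [e1, e2, e3, e4] at this
    rw [this.dvd_iff dvd_rfl, hp.dvd_mul, not_or]
    refine ⟨?_, ih hl⟩
    intro h
    have h3 : p ∣ (k * d).factorial := h.trans ((Dvd.intro _ rfl).trans (Dvd.intro _
      (Nat.choose_mul_factorial_mul_factorial (Nat.le_mul_of_pos_left d (by omega)))))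
    exact absurd ((hp.dvd_factorial).mp h3) (by omega)

section JacobiSum

variable {F : Type*} [Field F] [Fintype F] {k n : ℕ}

theorem sum_pow_eq_ite {M : ℕ} (h0 : 0 < M) (h1 : M < 2 * (Fintype.card F - 1)) :
    ∑ x : F, x ^ M = if M = Fintype.card F - 1 then -1 else 0 := by
  classical
  have h : ∑ x : F, x ^ M = ∑ x : Fˣ, (x ^ M : F) := by
    rw [Fintype.sum_eq_add_sum_compl 0, zero_pow h0.ne', zero_add]
    symm
    refine Finset.sum_bij (fun b _ => (b : F)) (by simp)
      (fun _ _ _ _ h => Units.ext h) ?_ (fun _ _ => rfl)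
    intro b hb
    exact ⟨Units.mk0 b (by simpa using hb), by simp, rfl⟩
  rw [h, FiniteField.sum_pow_units]
  refine if_congr ⟨?_, fun h => h ▸ dvd_rfl⟩ rfl rfl
  rintro ⟨c, rfl⟩
  have hc : c < 2 := by
    by_contra hc
    push Not at hc
    nlinarith [Nat.zero_le (Fintype.card F - 1)]
  interval_cases c
  · simp at h0
  · simp

/-- The power sums of `x (1 - x)`. -/
theorem sum_mul_one_sub_pow {N : ℕ} (h0 : 0 < N) (h1 : N < Fintype.card F - 1) :
    ∑ x : F, (x * (1 - x)) ^ N =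
      if Fintype.card F - 1 ≤ 2 * N then
        -((-1) ^ (Fintype.card F - 1 - N) * (N.choose (Fintype.card F - 1 - N) : F)) else 0 := by
  classical
  have h : ∀ x : F, (x * (1 - x)) ^ N =
      ∑ i ∈ Finset.range (N + 1), (-1) ^ i * (N.choose i : F) * x ^ (N + i) := by
    intro x
    rw [mul_pow, sub_eq_neg_add, add_pow, Finset.mul_sum]
    refine Finset.sum_congr rfl fun i _ => ?_
    rw [neg_pow, one_pow, pow_add]; ring
  simp_rw [h]
  rw [Finset.sum_comm]
  simp_rw [← Finset.mul_sum]
  have h2 : ∀ i ∈ Finset.range (N + 1), (-1) ^ i * (N.choose i : F) * ∑ x : F, x ^ (N + i) =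
      if i = Fintype.card F - 1 - N then
        -((-1) ^ (Fintype.card F - 1 - N) * (N.choose (Fintype.card F - 1 - N) : F)) else 0 := by
    intro i hi
    rw [Finset.mem_range] at hi
    rw [sum_pow_eq_ite (by omega) (by omega)]
    by_cases h3 : i = Fintype.card F - 1 - N
    · rw [if_pos h3, if_pos (by omega), h3]; ring
    · rw [if_neg h3, if_neg (by omega), mul_zero]
  rw [Finset.sum_congr rfl h2, Finset.sum_ite_eq']
  refine if_congr ?_ rfl rfl
  rw [Finset.mem_range]
  omega

/-- χ(x) in ℂ and x^n in `F` are k-th roots of unity satisfying the same cyclotomic equation, and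
for x ≠ 0 the power x^((k-1)n) is the inverse of x^n. For k = 3, 4 a k-th root of unity plus its
inverse is an integer, the same on both sides. -/
theorem exists_int_eq_mulChar_add_inv (hk : k = 3 ∨ k = 4) (hkn : Fintype.card F = k * n + 1)
    (hn : 0 < n) {χ : MulChar F ℂ} (hχ : orderOf χ = k) (x : F) :
    ∃ z : ℤ, χ x + χ⁻¹ x = z ∧ (z : F) = x ^ n + x ^ ((k - 1) * n) := by
  rcases eq_or_ne x 0 with rfl | hx
  · refine ⟨0, by simp [MulChar.map_zero], ?_⟩
    rw [zero_pow hn.ne', zero_pow (mul_ne_zero (by omega) hn.ne')]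
    simp
  have hw1 := mulChar_eq_one_iff hkn hn hχ hx
  have hw2 := mulChar_eq_one_iff hkn hn hχ (pow_ne_zero 2 hx)
  have hz := mulChar_pow_eq_one (by omega) hχ hx
  have hw : (x ^ n) ^ k = 1 := by
    rw [← pow_mul, mul_comm n k, ← FiniteField.pow_card_sub_one_eq_one x hx, hkn,
      Nat.add_sub_cancel]
  have hz0 : χ x ≠ 0 := MulChar.apply_ne_zero_iff.mpr (Ne.isUnit hx)
  rw [MulChar.inv_apply_eq_inv', mul_comm (k - 1) n, pow_mul]
  rw [map_pow, pow_right_comm] at hw2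
  generalize χ x = z at *
  generalize x ^ n = w at *
  by_cases h1 : w = 1
  · refine ⟨2, ?_, ?_⟩
    · rw [hw1.mpr h1]; norm_num
    · rw [h1]; norm_num
  have h1' : z ≠ 1 := fun h => h1 (hw1.mp h)
  rcases hk with rfl | rfl
  · have hz' : z ^ 2 + z + 1 = 0 := by
      have : (z - 1) * (z ^ 2 + z + 1) = 0 := by linear_combination hz
      exact (mul_eq_zero.mp this).resolve_left (sub_ne_zero.mpr h1')
    have hw' : w ^ 2 + w + 1 = 0 := by
      have : (w - 1) * (w ^ 2 + w + 1) = 0 := by linear_combination hw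
      exact (mul_eq_zero.mp this).resolve_left (sub_ne_zero.mpr h1)
    refine ⟨-1, ?_, ?_⟩
    · field_simp; push_cast; linear_combination hz'
    · push_cast; linear_combination -hw'
  · by_cases h2 : w ^ 2 = 1
    · have hz2 := hw2.mpr h2
      have hz' : z = -1 := (sq_eq_one_iff.mp hz2).resolve_left h1'
      have hw' : w = -1 := (sq_eq_one_iff.mp h2).resolve_left h1
      exact ⟨-2, by rw [hz']; norm_num, by rw [hw']; norm_num⟩
    · have h2' : z ^ 2 ≠ 1 := fun h => h2 (hw2.mp h)
      have hz' : z ^ 2 + 1 = 0 := by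
        have : (z ^ 2 - 1) * (z ^ 2 + 1) = 0 := by linear_combination hz
        exact (mul_eq_zero.mp this).resolve_left (sub_ne_zero.mpr h2')
      have hw' : w ^ 2 + 1 = 0 := by
        have : (w ^ 2 - 1) * (w ^ 2 + 1) = 0 := by linear_combination hw
        exact (mul_eq_zero.mp this).resolve_left (sub_ne_zero.mpr h2)
      refine ⟨0, ?_, ?_⟩
      · field_simp; push_cast; linear_combination hz'
      · push_cast; linear_combination -w * hw'

/-- If `p ≡ 1 (mod k)` for `k = 3` or `k = 4`, then the trace of the Jacobi sum `J(χ, χ)` of a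
character of order `k` is an integer prime to `p`. -/
theorem exists_int_eq_jacobiSum_add_jacobiSum_inv {p m : ℕ} [hp : Fact p.Prime] [CharP F p]
    (hk : k = 3 ∨ k = 4) (hpk : p ≡ 1 [MOD k]) (hq : Fintype.card F = p ^ m)
    (hkn : Fintype.card F = k * n + 1) (hn : 0 < n) {χ : MulChar F ℂ} (hχ : orderOf χ = k) :
    ∃ T : ℤ, jacobiSum χ χ + jacobiSum χ⁻¹ χ⁻¹ = T ∧ ¬ (p : ℤ) ∣ T := by
  choose z hz hzF using exists_int_eq_mulChar_add_inv hk hkn hn hχ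
  refine ⟨∑ x : F, z (x * (1 - x)), ?_, ?_⟩
  · rw [jacobiSum, jacobiSum, ← Finset.sum_add_distrib, Int.cast_sum]
    refine Finset.sum_congr rfl fun x _ => ?_
    rw [← hz, map_mul, map_mul]
  · rw [← CharP.intCast_eq_zero_iff F p, Int.cast_sum]
    simp_rw [hzF]
    -- Of the two power sums of x(1 - x), the one with exponent n vanishes since 2n < q - 1; the one
    -- with exponent (k-1)n is, up to sign, the binomial coefficient of Lucas' theorem.
    have e : Fintype.card F - 1 - (k - 1) * n = n := by
      rw [hkn]
      rcases hk with rfl | rfl <;> simp <;> omega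
    rw [Finset.sum_add_distrib, sum_mul_one_sub_pow hn, sum_mul_one_sub_pow, e,
      if_neg, if_pos, zero_add, neg_eq_zero, mul_eq_zero, CharP.cast_eq_zero_iff F p, not_or]
    · refine ⟨pow_ne_zero _ (neg_ne_zero.mpr one_ne_zero), ?_⟩
      obtain ⟨d, hd⟩ := (Nat.modEq_iff_dvd' hp.out.one_lt.le).mp hpk.symm
      exact not_dvd_choose_of_mul_add_one_eq_pow hp.out (d := d)
        (by have := hp.out.one_lt; omega) (by omega) (hkn ▸ hq)
    all_goals first | rw [hkn] | skip
    all_goals rcases hk with rfl | rfl <;> simp <;> omega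

end JacobiSum

/-! ### Periods in terms of Gauss sums -/

section GaussSums

variable {F : Type*} [Field F] {k n : ℕ}

theorem neg_one_pow_eq_one_of_dvd {p : ℕ} [hp : Fact p.Prime] [CharP F p] (hpn : p - 1 ∣ n) :
    (-1 : F) ^ n = 1 := by
  obtain ⟨c, rfl⟩ := hpn
  rcases hp.out.eq_two_or_odd' with rfl | h
  · rw [CharTwo.neg_eq, one_pow]
  · rw [pow_mul, (Nat.Odd.sub_odd h odd_one).neg_one_pow, one_pow]

theorem isIntegral_mulChar (hk : k ≠ 0) {χ : MulChar F ℂ} (hχ : orderOf χ = k) (x : F) :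
    IsIntegral ℤ (χ x) := by
  rcases eq_or_ne x 0 with rfl | hx
  · rw [MulChar.map_zero]; exact isIntegral_zero
  · exact IsIntegral.of_pow (Nat.pos_of_ne_zero hk)
      (by rw [mulChar_pow_eq_one hk hχ hx]; exact isIntegral_one)

variable [Fintype F]

theorem gaussSum_mul_gaussSum_inv {ψ : AddChar F ℂ} (hψ : ψ.IsPrimitive) {χ : MulChar F ℂ}
    (hχ : χ ≠ 1) (h : χ (-1) = 1) :
    gaussSum χ ψ * gaussSum χ⁻¹ ψ = Fintype.card F := by
  have h' : χ⁻¹ (-1) = 1 := by rw [MulChar.inv_apply_eq_inv', h, inv_one]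
  rw [← gaussSum_mul_gaussSum_eq_card hχ hψ, ← mul_gaussSum_inv_eq_gaussSum χ⁻¹ ψ, h', one_mul]

theorem isIntegral_jacobiSum (hk : k ≠ 0) {χ : MulChar F ℂ} (hχ : orderOf χ = k) :
    IsIntegral ℤ (jacobiSum χ χ) :=
  IsIntegral.sum _ fun _ _ => (isIntegral_mulChar hk hχ _).mul (isIntegral_mulChar hk hχ _)

theorem exists_mulChar_orderOf_eq (hk : k ≠ 0) (hkn : Fintype.card F = k * n + 1) :
    ∃ χ : MulChar F ℂ, orderOf χ = k :=
  MulChar.exists_mulChar_orderOf F ⟨n, by rw [hkn, Nat.add_sub_cancel]⟩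
    (Complex.isPrimitiveRoot_exp k hk)

/-- The generalized Paley graph and the generalized Paley sum graph have the same energy when the
prime field consists of `k`-th powers. -/
theorem graphEnergy_gpSumGraph {p : ℕ} [Fact p.Prime] [CharP F p]
    (hkn : Fintype.card F = k * n + 1) (hn : 0 < n) (hpn : p - 1 ∣ n) :
    graphEnergy (gpSumGraph k F) = graphEnergy (gpGraph k F) := by
  refine graphEnergy_cayleySumGraph fun x => ?_
  rcases eq_or_ne x 0 with rfl | hx
  · rw [neg_zero]
  · rw [mem_nonzeroPowers_iff hkn hn hx, mem_nonzeroPowers_iff hkn hn (neg_ne_zero.mpr hx),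
      neg_pow, neg_one_pow_eq_one_of_dvd hpn, one_mul]

/-- The eigenvalues of the cubic Paley graph. -/
theorem exists_cubic_periods {p m : ℕ} [hp : Fact p.Prime] [CharP F p]
    (hq : Fintype.card F = p ^ m) (hkn : Fintype.card F = 3 * n + 1) (hn : 0 < n)
    (hpn : p - 1 ∣ n) :
    ∃ x : ℕ → ℤ,
      graphEnergy (gpGraph 3 F) =
        n + n / 3 * (|(x 0 : ℝ) - 1| + |(x 1 : ℝ) - 1| + |(x 2 : ℝ) - 1|) ∧
      (∀ i, x i ≡ 1 [ZMOD 3]) ∧ x 0 + x 1 + x 2 = 0 ∧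
      x 0 ^ 2 + x 1 ^ 2 + x 2 ^ 2 = 6 * (p : ℤ) ^ m ∧
      (p ≡ 1 [MOD 3] → ∀ r : ℤ, (p : ℤ) ^ m = r ^ 3 → (p : ℤ) ∣ r →
        ∀ i, ∃ a : ℤ, x i = r * a ∧ ¬ (p : ℤ) ∣ a) := by
  classical
  obtain ⟨χ, hχ⟩ := exists_mulChar_orderOf_eq (F := F) (by norm_num : (3 : ℕ) ≠ 0) hkn
  obtain ⟨g, hg⟩ := IsCyclic.exists_generator (α := Fˣ)
  have hψ : (AddChar.FiniteField.primitiveChar_to_Complex F).IsPrimitive :=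
    AddChar.FiniteField.primitiveChar_to_Complex_isPrimitive F
  generalize AddChar.FiniteField.primitiveChar_to_Complex F = ψ at hψ
  have hψ1 : ψ ≠ 1 := fun h =>
    hψ (one_ne_zero : (1 : F) ≠ 0) (by rw [AddChar.mulShift_one, h])
  have hχ3 : χ ^ 3 = 1 := hχ ▸ pow_orderOf_eq_one χ
  have hχ1 : χ ≠ 1 := fun h => by rw [h, orderOf_one] at hχ; norm_num at hχ
  have hχi : χ ^ 2 = χ⁻¹ := eq_inv_of_mul_eq_one_left (by rw [← pow_succ, hχ3])
  have hχχ : χ * χ = χ⁻¹ := by rw [← pow_two, hχi]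
  have hχχi : χ⁻¹ * χ⁻¹ = χ := by rw [← mul_inv, hχχ, inv_inv]
  have hχm : χ (-1) = 1 := (mulChar_eq_one_iff hkn hn hχ (neg_ne_zero.mpr one_ne_zero)).mpr
    (neg_one_pow_eq_one_of_dvd hpn)
  have hζ := isPrimitiveRoot_mulChar_generator hg hχ
  obtain ⟨e, he⟩ : ∃ e : ℕ → ℤ, ∀ j, gaussianPeriod ψ 3 ((g ^ j : Fˣ) : F) = e j := by
    choose e he using exists_int_eq_gaussianPeriod (by norm_num) hkn hn hpn ψ hχ
    exact ⟨fun j => e ((g ^ j : Fˣ) : F), fun j => he _⟩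
  have hGH := gaussSum_mul_gaussSum_inv hψ hχ1 hχm
  have hJ := jacobiSum_mul_nontrivial (χ := χ) (φ := χ) (by rw [hχχ]; exact inv_ne_one.mpr hχ1) ψ
  have hJi := jacobiSum_mul_nontrivial (χ := χ⁻¹) (φ := χ⁻¹) (by rw [hχχi]; exact hχ1) ψ
  rw [hχχ] at hJ
  rw [hχχi] at hJi
  have hx : ∀ j, ((3 * e j + 1 : ℤ) : ℂ) = ((χ g)⁻¹) ^ j * gaussSum χ ψ +
      ((χ g)⁻¹) ^ (2 * j) * gaussSum χ⁻¹ ψ := by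
    intro j
    have h := mul_gaussianPeriod (by norm_num) hkn hn hψ1 hχ (g ^ j)
    rw [he, Finset.sum_Ico_succ_top (by norm_num), Finset.sum_Ico_succ_top (by norm_num),
      Finset.Ico_self, Finset.sum_empty, zero_add, pow_one, pow_one, hχi,
      Units.val_pow_eq_pow_val, map_pow] at h
    push_cast at h ⊢
    rw [h]
    ring
  have hint := isIntegral_jacobiSum (by norm_num) hχ
  have hinti := isIntegral_jacobiSum (by norm_num) ((orderOf_inv χ).trans hχ)
  have hT := fun hp1 : p ≡ 1 [MOD 3] =>
    exists_int_eq_jacobiSum_add_jacobiSum_inv (Or.inl rfl) hp1 hq hkn hn hχ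
  have hq' : ((Fintype.card F : ℕ) : ℂ) = (p : ℂ) ^ m := by rw [hq]; push_cast; rfl
  have hc3 : ((χ g)⁻¹) ^ 3 = 1 := by rw [inv_pow, hζ.pow_eq_one, inv_one]
  have hc1 : (χ g)⁻¹ ≠ 1 := fun h => hζ.ne_one (by norm_num) (inv_eq_one.mp h)
  rw [hq'] at hGH
  have henergy := graphEnergy_gpGraph (by norm_num) hkn hn hψ hχ hg
  simp_rw [he] at henergy
  generalize gaussSum χ ψ = G at *
  generalize gaussSum χ⁻¹ ψ = H at *
  generalize jacobiSum χ χ = J at *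
  generalize jacobiSum χ⁻¹ χ⁻¹ = J' at *
  generalize (χ g)⁻¹ = c at *
  have hc : c ^ 2 + c + 1 = 0 := by
    have : (c - 1) * (c ^ 2 + c + 1) = 0 := by linear_combination hc3
    exact (mul_eq_zero.mp this).resolve_left (sub_ne_zero.mpr hc1)
  refine ⟨fun j => 3 * e j + 1, ?_, ?_, ?_, ?_, ?_⟩
  · rw [henergy]
    simp only [Finset.sum_range_succ, Finset.sum_range_zero, Complex.norm_intCast]
    have h3 : ∀ t : ℝ, |3 * t + 1 - 1| = 3 * |t| := fun t => by
      rw [add_sub_cancel_right, abs_mul, abs_of_pos (by norm_num : (0 : ℝ) < 3)]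
    push_cast
    rw [h3, h3, h3]
    ring
  · intro i
    simp [Int.modEq_iff_dvd]
  · have : (((3 * e 0 + 1) + (3 * e 1 + 1) + (3 * e 2 + 1) : ℤ) : ℂ) = 0 := by
      rw [Int.cast_add, Int.cast_add, hx, hx, hx]
      linear_combination (G + H + (c ^ 2 - c) * H) * hc
    exact_mod_cast this
  · have : (((3 * e 0 + 1) ^ 2 + (3 * e 1 + 1) ^ 2 + (3 * e 2 + 1) ^ 2 : ℤ) : ℂ) =
        ((6 * (p : ℤ) ^ m : ℤ) : ℂ) := by
      rw [Int.cast_add, Int.cast_add, Int.cast_pow, Int.cast_pow, Int.cast_pow, hx, hx, hx]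
      push_cast
      have h4 : c ^ 4 = c := by linear_combination c * hc3
      have h6 : c ^ 6 = 1 := by linear_combination (c ^ 3 + 1) * hc3
      have h8 : c ^ 8 = c ^ 2 := by linear_combination (c ^ 5 + c ^ 2) * hc3
      linear_combination 6 * hGH + (G ^ 2 + H ^ 2) * hc + G ^ 2 * h4 +
        H ^ 2 * h4 + H ^ 2 * h8 + 2 * G * H * (hc3 + h6)
    exact Int.cast_injective this
  · intro hp1 r hr hpr i
    obtain ⟨T, hTJ, hpT⟩ := hT hp1
    have hr0 : r ≠ 0 := by
      rintro rfl
      have : (p : ℤ) ^ m ≠ 0 := pow_ne_zero _ (by exact_mod_cast hp.out.ne_zero)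
      exact this (by simpa using hr)
    have hr0' : (r : ℂ) ≠ 0 := by exact_mod_cast hr0
    have hr' : (p : ℂ) ^ m = (r : ℂ) ^ 3 := by exact_mod_cast hr
    rw [hr'] at hGH
    have hci : (c ^ i) ^ 3 = 1 := by rw [← pow_mul, mul_comm, pow_mul, hc3, one_pow]
    have hci6 : (c ^ (2 * i)) ^ 3 = 1 := by rw [← pow_mul, mul_comm, pow_mul, hc3, one_pow]
    have hci2 : c ^ i * c ^ (2 * i) = 1 := by
      rw [← pow_add, show i + 2 * i = 3 * i by ring, pow_mul, hc3, one_pow]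
    -- HJ = G² and GH = r³ give G³ = r³J, so G/r is a cube root of an algebraic integer.
    have hα : (c ^ i * G / r) ^ 3 = J := by
      field_simp
      linear_combination G ^ 3 * hci - G * hJ + J * hGH
    have hβ : (c ^ (2 * i) * H / r) ^ 3 = J' := by
      field_simp
      linear_combination H ^ 3 * hci6 - H * hJi + J' * hGH
    have hαβ : (c ^ i * G / r) * (c ^ (2 * i) * H / r) = r := by
      field_simp
      linear_combination G * H * hci2 + hGH
    have hαi : IsIntegral ℤ (c ^ i * G / r) :=
      IsIntegral.of_pow (n := 3) (by norm_num) (hα ▸ hint)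
    have hβi : IsIntegral ℤ (c ^ (2 * i) * H / r) :=
      IsIntegral.of_pow (n := 3) (by norm_num) (hβ ▸ hinti)
    have hrx : (r : ℂ) * (c ^ i * G / r + c ^ (2 * i) * H / r) = ((3 * e i + 1 : ℤ) : ℂ) := by
      rw [hx]; field_simp
    obtain ⟨a, ha⟩ := exists_int_eq_of_isIntegral_of_mul_eq (hαi.add hβi) hr0 hrx
    refine ⟨a, ?_, fun hpa => hpT ?_⟩
    · rw [ha] at hrx
      exact_mod_cast hrx.symm
    -- With α³ = J, β³ = J', αβ = r and α + β = a, this is the identity for α³ + β³.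
    · have : T = a ^ 3 - 3 * r * a := by
        have : (T : ℂ) = ((a ^ 3 - 3 * r * a : ℤ) : ℂ) := by
          push_cast
          rw [← ha, ← hTJ, ← hα, ← hβ]
          generalize c ^ i * G / r = α at *
          generalize c ^ (2 * i) * H / r = β at *
          linear_combination -3 * (α + β) * hαβ
        exact_mod_cast this
      rw [this]
      exact dvd_sub (dvd_pow hpa (by norm_num)) (Dvd.dvd.mul_left hpa _)

/-- The eigenvalues of the quartic Paley graph. -/
theorem exists_quartic_periods {p m : ℕ} [hp : Fact p.Prime] [CharP F p]
    (hq : Fintype.card F = p ^ m) (hkn : Fintype.card F = 4 * n + 1) (hn : 0 < n)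
    (hpn : p - 1 ∣ n) :
    ∃ x A B : ℤ,
      graphEnergy (gpGraph 4 F) = n + n / 4 * (|(x : ℝ) + 2 * A - 1| + |(x : ℝ) - 2 * A - 1| +
        |-(x : ℝ) + 2 * B - 1| + |-(x : ℝ) - 2 * B - 1|) ∧
      x + 2 * A ≡ 1 [ZMOD 4] ∧ -x + 2 * B ≡ 1 [ZMOD 4] ∧
      A ^ 2 + B ^ 2 = (p : ℤ) ^ m ∧ x ^ 2 = (p : ℤ) ^ m ∧
      (p ≡ 1 [MOD 4] → ∀ u : ℤ, (p : ℤ) ^ m = u ^ 4 → (p : ℤ) ∣ u → Odd u →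
        ∃ s t : ℤ, A = u * s ∧ B = u * t ∧ s ^ 2 + t ^ 2 = u ^ 2 ∧
          ¬ (p : ℤ) ∣ s ∧ ¬ (p : ℤ) ∣ t) := by
  classical
  obtain ⟨χ, hχ⟩ := exists_mulChar_orderOf_eq (F := F) (by norm_num : (4 : ℕ) ≠ 0) hkn
  obtain ⟨g, hg⟩ := IsCyclic.exists_generator (α := Fˣ)
  have hψ : (AddChar.FiniteField.primitiveChar_to_Complex F).IsPrimitive :=
    AddChar.FiniteField.primitiveChar_to_Complex_isPrimitive F
  generalize AddChar.FiniteField.primitiveChar_to_Complex F = ψ at hψ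
  have hψ1 : ψ ≠ 1 := fun h =>
    hψ (one_ne_zero : (1 : F) ≠ 0) (by rw [AddChar.mulShift_one, h])
  have hχ4 : χ ^ 4 = 1 := hχ ▸ pow_orderOf_eq_one χ
  have hχ1 : χ ≠ 1 := fun h => by rw [h, orderOf_one] at hχ; norm_num at hχ
  have hχ2 : χ ^ 2 ≠ 1 := fun h => by
    have := orderOf_dvd_of_pow_eq_one h
    rw [hχ] at this
    norm_num at this
  have hχi : χ ^ 3 = χ⁻¹ := eq_inv_of_mul_eq_one_left (by rw [← pow_succ, hχ4])
  have hχi2 : (χ ^ 2)⁻¹ = χ ^ 2 := inv_eq_of_mul_eq_one_left (by rw [← pow_add, hχ4])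
  have hχχ : χ * χ = χ ^ 2 := (pow_two χ).symm
  have hχχi : χ⁻¹ * χ⁻¹ = χ ^ 2 := by rw [← mul_inv, hχχ, hχi2]
  have hχm : χ (-1) = 1 := (mulChar_eq_one_iff hkn hn hχ (neg_ne_zero.mpr one_ne_zero)).mpr
    (neg_one_pow_eq_one_of_dvd hpn)
  have hχm2 : (χ ^ 2) (-1) = 1 := by rw [MulChar.pow_apply' _ (by norm_num), hχm, one_pow]
  have hζ := isPrimitiveRoot_mulChar_generator hg hχ
  obtain ⟨e, he⟩ : ∃ e : ℕ → ℤ, ∀ j, gaussianPeriod ψ 4 ((g ^ j : Fˣ) : F) = e j := by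
    choose e he using exists_int_eq_gaussianPeriod (by norm_num) hkn hn hpn ψ hχ
    exact ⟨fun j => e ((g ^ j : Fˣ) : F), fun j => he _⟩
  have hGH := gaussSum_mul_gaussSum_inv hψ hχ1 hχm
  have hKK := gaussSum_mul_gaussSum_inv hψ hχ2 hχm2
  rw [hχi2] at hKK
  have hJ := jacobiSum_mul_nontrivial (χ := χ) (φ := χ) (by rwa [hχχ]) ψ
  have hJi := jacobiSum_mul_nontrivial (χ := χ⁻¹) (φ := χ⁻¹) (by rwa [hχχi]) ψ
  rw [hχχ] at hJ
  rw [hχχi] at hJi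
  have hx : ∀ j, ((4 * e j + 1 : ℤ) : ℂ) = ((χ g)⁻¹) ^ j * gaussSum χ ψ +
      ((χ g)⁻¹) ^ (2 * j) * gaussSum (χ ^ 2) ψ + ((χ g)⁻¹) ^ (3 * j) * gaussSum χ⁻¹ ψ := by
    intro j
    have h := mul_gaussianPeriod (by norm_num) hkn hn hψ1 hχ (g ^ j)
    rw [he, Finset.sum_Ico_succ_top (by norm_num), Finset.sum_Ico_succ_top (by norm_num),
      Finset.sum_Ico_succ_top (by norm_num),
      Finset.Ico_self, Finset.sum_empty, zero_add, pow_one, pow_one, hχi,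
      Units.val_pow_eq_pow_val, map_pow] at h
    push_cast at h ⊢
    rw [h]
    ring
  have hint := isIntegral_jacobiSum (by norm_num) hχ
  have hinti := isIntegral_jacobiSum (by norm_num) ((orderOf_inv χ).trans hχ)
  have hT := fun hp1 : p ≡ 1 [MOD 4] =>
    exists_int_eq_jacobiSum_add_jacobiSum_inv (Or.inr rfl) hp1 hq hkn hn hχ
  have hq' : ((Fintype.card F : ℕ) : ℂ) = (p : ℂ) ^ m := by rw [hq]; push_cast; rfl
  have hc4 : ((χ g)⁻¹) ^ 4 = 1 := by rw [inv_pow, hζ.pow_eq_one, inv_one]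
  have hc2 : ((χ g)⁻¹) ^ 2 ≠ 1 := fun h =>
    hζ.pow_ne_one_of_pos_of_lt two_ne_zero (by norm_num) (inv_eq_one.mp (by rw [← inv_pow, h]))
  rw [hq'] at hGH hKK
  have henergy := graphEnergy_gpGraph (by norm_num) hkn hn hψ hχ hg
  simp_rw [he] at henergy
  generalize gaussSum χ ψ = G at *
  generalize gaussSum χ⁻¹ ψ = H at *
  generalize gaussSum (χ ^ 2) ψ = K at *
  generalize jacobiSum χ χ = J at *
  generalize jacobiSum χ⁻¹ χ⁻¹ = J' at *
  generalize (χ g)⁻¹ = c at *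
  have hc : c ^ 2 = -1 := by
    have : (c ^ 2 - 1) * (c ^ 2 + 1) = 0 := by linear_combination hc4
    exact eq_neg_of_add_eq_zero_left ((mul_eq_zero.mp this).resolve_left (sub_ne_zero.mpr hc2))
  have hx0 := hx 0
  have hx1 := hx 1
  have hx2 := hx 2
  have hx3 := hx 3
  have h3 : c ^ 3 = -c := by linear_combination c * hc
  have h6 : c ^ 6 = -1 := by linear_combination (c ^ 4 - c ^ 2 + 1) * hc
  have h9 : c ^ 9 = c := by linear_combination (c ^ 5 + c) * hc4
  norm_num [hc, h3, hc4, h6, h9] at hx0 hx1 hx2 hx3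
  -- As c² = -1, adding the equations for j and j + 2 isolates the quadratic Gauss sum K;
  -- subtracting them isolates G + H and c(G - H).
  have hK : K = ((2 * (e 0 + e 2) + 1 : ℤ) : ℂ) := by
    push_cast; linear_combination -(1 / 2) * hx0 - (1 / 2) * hx2
  have hA : G + H = ((2 * (e 0 - e 2) : ℤ) : ℂ) := by
    push_cast; linear_combination -(1 / 2) * hx0 + (1 / 2) * hx2
  have hB : c * (G - H) = ((2 * (e 1 - e 3) : ℤ) : ℂ) := by
    push_cast; linear_combination -(1 / 2) * hx1 + (1 / 2) * hx3
  have hs : e 1 + e 3 = -(e 0 + e 2) - 1 := by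
    have : ((e 1 + e 3 : ℤ) : ℂ) = ((-(e 0 + e 2) - 1 : ℤ) : ℂ) := by
      push_cast; linear_combination (1 / 4) * (hx0 + hx1 + hx2 + hx3)
    exact Int.cast_injective this
  have hAB : (e 0 - e 2) ^ 2 + (e 1 - e 3) ^ 2 = (p : ℤ) ^ m := by
    have : (((e 0 - e 2) ^ 2 + (e 1 - e 3) ^ 2 : ℤ) : ℂ) = (((p : ℤ) ^ m : ℤ) : ℂ) := by
      push_cast at hA hB ⊢
      have h1 : (e 0 - e 2 : ℂ) = (G + H) / 2 := by rw [hA]; ring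
      have h2 : (e 1 - e 3 : ℂ) = c * (G - H) / 2 := by rw [hB]; ring
      rw [h1, h2]
      linear_combination hGH + (G - H) ^ 2 / 4 * hc
    exact Int.cast_injective this
  have hKi : (2 * (e 0 + e 2) + 1) ^ 2 = (p : ℤ) ^ m := by
    have : (((2 * (e 0 + e 2) + 1) ^ 2 : ℤ) : ℂ) = (((p : ℤ) ^ m : ℤ) : ℂ) := by
      rw [Int.cast_pow, ← hK, pow_two, hKK]; push_cast; rfl
    exact Int.cast_injective this
  refine ⟨2 * (e 0 + e 2) + 1, e 0 - e 2, e 1 - e 3, ?_, ?_, ?_, hAB, hKi, ?_⟩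
  · rw [henergy]
    simp only [Finset.sum_range_succ, Finset.sum_range_zero, Complex.norm_intCast]
    have h4 : ∀ t : ℝ, |4 * t| = 4 * |t| := fun t => by
      rw [abs_mul, abs_of_pos (by norm_num : (0 : ℝ) < 4)]
    have hs' : (e 1 + e 3 : ℝ) = -(e 0 + e 2) - 1 := by exact_mod_cast hs
    have e0 : ((2 * (e 0 + e 2) + 1 : ℤ) : ℝ) + 2 * ((e 0 - e 2 : ℤ) : ℝ) - 1 = 4 * e 0 := by
      push_cast; ring
    have e2 : ((2 * (e 0 + e 2) + 1 : ℤ) : ℝ) - 2 * ((e 0 - e 2 : ℤ) : ℝ) - 1 = 4 * e 2 := by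
      push_cast; ring
    have e1 : -((2 * (e 0 + e 2) + 1 : ℤ) : ℝ) + 2 * ((e 1 - e 3 : ℤ) : ℝ) - 1 = 4 * e 1 := by
      push_cast; linear_combination -2 * hs'
    have e3 : -((2 * (e 0 + e 2) + 1 : ℤ) : ℝ) - 2 * ((e 1 - e 3 : ℤ) : ℝ) - 1 = 4 * e 3 := by
      push_cast; linear_combination -2 * hs'
    rw [e0, e1, e2, e3, h4, h4, h4, h4]
    ring
  · rw [Int.modEq_iff_dvd]; exact ⟨-e 0, by ring⟩
  · rw [Int.modEq_iff_dvd]; exact ⟨-e 1, by linear_combination 2 * hs⟩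
  · intro hp1 u hu hpu huo
    obtain ⟨T, hTJ, hpT⟩ := hT hp1
    have hu0 : u ≠ 0 := by rintro rfl; simp at huo
    have hu0' : (u : ℂ) ≠ 0 := by exact_mod_cast hu0
    have hu' : (p : ℂ) ^ m = (u : ℂ) ^ 4 := by exact_mod_cast hu
    rw [hu'] at hGH hKK
    -- KJ = G² and K² = u⁴ give G⁴ = u⁴J².
    have hα : (G / u) ^ 4 = J ^ 2 := by
      field_simp
      linear_combination -(G ^ 2 + K * J) * hJ + J ^ 2 * hKK
    have hβ : (H / u) ^ 4 = J' ^ 2 := by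
      field_simp
      linear_combination -(H ^ 2 + K * J') * hJi + J' ^ 2 * hKK
    have hαi : IsIntegral ℤ (G / u) :=
      IsIntegral.of_pow (n := 4) (by norm_num) (hα ▸ hint.pow 2)
    have hβi : IsIntegral ℤ (H / u) :=
      IsIntegral.of_pow (n := 4) (by norm_num) (hβ ▸ hinti.pow 2)
    have hci : IsIntegral ℤ c := IsIntegral.of_pow (n := 4) (by norm_num) (hc4 ▸ isIntegral_one)
    have hcop : IsCoprime u 2 := Int.isCoprime_two_right.mpr huo
    obtain ⟨s', hs'⟩ := exists_int_eq_of_isIntegral_of_mul_eq (hαi.add hβi) hu0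
      (b := 2 * (e 0 - e 2)) (by rw [← hA]; field_simp)
    obtain ⟨t', ht'⟩ := exists_int_eq_of_isIntegral_of_mul_eq (hci.mul (hαi.sub hβi)) hu0
      (b := 2 * (e 1 - e 3)) (by rw [← hB]; field_simp)
    have hus : u * s' = 2 * (e 0 - e 2) := by
      have : ((u * s' : ℤ) : ℂ) = ((2 * (e 0 - e 2) : ℤ) : ℂ) := by
        rw [Int.cast_mul, ← hs', ← hA]; field_simp
      exact Int.cast_injective this
    have hut : u * t' = 2 * (e 1 - e 3) := by
      have : ((u * t' : ℤ) : ℂ) = ((2 * (e 1 - e 3) : ℤ) : ℂ) := by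
        rw [Int.cast_mul, ← ht', ← hB]; field_simp
      exact Int.cast_injective this
    -- Integrality only gives u ∣ 2A and u ∣ 2B; the factor 2 is dropped because u is odd.
    obtain ⟨s, hs1⟩ : u ∣ e 0 - e 2 := hcop.dvd_of_dvd_mul_left ⟨s', hus.symm⟩
    obtain ⟨t, ht1⟩ : u ∣ e 1 - e 3 := hcop.dvd_of_dvd_mul_left ⟨t', hut.symm⟩
    have hst : s ^ 2 + t ^ 2 = u ^ 2 := by
      rw [hs1, ht1, hu] at hAB
      have : u ^ 2 * (s ^ 2 + t ^ 2) = u ^ 2 * u ^ 2 := by linear_combination hAB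
      exact mul_left_cancel₀ (pow_ne_zero 2 hu0) this
    have hpI : Prime (p : ℤ) := Nat.prime_iff_prime_int.mp hp.out
    have hps : ¬ (p : ℤ) ∣ s := by
      intro h
      apply hpT
      -- KT = G² + H² = (G + H)² - 2GH. Since K = ±u², this makes T = ±(4s² - 2u²), which p would
      -- divide along with s.
      have hKT : (2 * (e 0 + e 2) + 1) * T = u ^ 2 * (4 * s ^ 2 - 2 * u ^ 2) := by
        have : (((2 * (e 0 + e 2) + 1) * T : ℤ) : ℂ) =
            ((u ^ 2 * (4 * s ^ 2 - 2 * u ^ 2) : ℤ) : ℂ) := by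
          rw [hs1] at hA
          rw [Int.cast_mul, ← hK, ← hTJ]
          push_cast at hA ⊢
          linear_combination hJ + hJi - 2 * hGH + (G + H + 2 * u * s) * hA
        exact Int.cast_injective this
      have hdvd : (p : ℤ) ∣ 4 * s ^ 2 - 2 * u ^ 2 :=
        dvd_sub (Dvd.dvd.mul_left (dvd_pow h two_ne_zero) _)
          (Dvd.dvd.mul_left (dvd_pow hpu two_ne_zero) _)
      have hK2 : (2 * (e 0 + e 2) + 1) ^ 2 = (u ^ 2) ^ 2 := by rw [hKi, hu]; ring
      rcases sq_eq_sq_iff_eq_or_eq_neg.mp hK2 with h1 | h1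
      · rw [h1] at hKT
        rwa [mul_left_cancel₀ (pow_ne_zero 2 hu0) hKT]
      · rw [h1, neg_mul_comm] at hKT
        rw [← mul_left_cancel₀ (pow_ne_zero 2 hu0) hKT] at hdvd
        exact (dvd_neg).mp hdvd
    refine ⟨s, t, hs1, ht1, hst, hps, fun h => hps ?_⟩
    refine hpI.dvd_of_dvd_pow (n := 2) ?_
    rw [← dvd_add_left (dvd_pow h two_ne_zero), hst]
    exact dvd_pow hpu two_ne_zero

end GaussSums

/-! ### Binary quadratic forms and sums of absolute values -/

section Arithmetic

/-- If p ∤ z, then y/z is a cube root of unity modulo p. It equals 1 because 3 ∤ p - 1, so 3z² ≡ 0,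
contradicting p ≠ 3. -/
theorem dvd_of_dvd_sq_add_mul_add_sq {p : ℕ} [hp : Fact p.Prime] (h3 : p ≡ 2 [MOD 3]) {y z : ℤ}
    (h : (p : ℤ) ∣ y ^ 2 + y * z + z ^ 2) : (p : ℤ) ∣ y ∧ (p : ℤ) ∣ z := by
  simp only [← ZMod.intCast_zmod_eq_zero_iff_dvd _ p] at h ⊢
  push_cast at h
  generalize (y : ZMod p) = Y at *
  generalize (z : ZMod p) = Z at *
  by_cases hZ : Z = 0
  · subst hZ
    exact ⟨by simpa using h, rfl⟩
  exfalso
  have hw3 : (Y / Z) ^ 3 = 1 := by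
    rw [div_pow, div_eq_one_iff_eq (pow_ne_zero 3 hZ)]
    linear_combination (Y - Z) * h
  have hw0 : Y / Z ≠ 0 := fun h0 => by rw [h0] at hw3; norm_num at hw3
  have hwp := ZMod.pow_card_sub_one_eq_one hw0
  have hcop : Nat.Coprime 3 (p - 1) := by
    rw [Nat.Prime.coprime_iff_not_dvd Nat.prime_three]
    have := hp.out.two_le
    unfold Nat.ModEq at h3
    omega
  have hw1 : Y / Z = 1 := by
    have h1 := Nat.dvd_gcd (orderOf_dvd_of_pow_eq_one hw3) (orderOf_dvd_of_pow_eq_one hwp)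
    rw [Nat.Coprime.gcd_eq_one hcop, Nat.dvd_one] at h1
    exact orderOf_eq_one_iff.mp h1
  rw [div_eq_one_iff_eq hZ] at hw1
  rw [hw1] at h
  have h3' : ((3 : ℕ) : ZMod p) = 0 := by
    have : Z ^ 2 * 3 = 0 := by linear_combination h
    simpa [hZ] using this
  rw [ZMod.natCast_eq_zero_iff, Nat.prime_dvd_prime_iff_eq hp.out Nat.prime_three] at h3'
  subst h3'
  exact absurd h3 (by decide)

/-- -1 is not a square modulo p. -/
theorem dvd_of_dvd_sq_add_sq {p : ℕ} [hp : Fact p.Prime] (h4 : p ≡ 3 [MOD 4]) {y z : ℤ}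
    (h : (p : ℤ) ∣ y ^ 2 + z ^ 2) : (p : ℤ) ∣ y ∧ (p : ℤ) ∣ z := by
  simp only [← ZMod.intCast_zmod_eq_zero_iff_dvd _ p] at h ⊢
  push_cast at h
  by_cases hz : (z : ZMod p) = 0
  · rw [hz] at h
    exact ⟨by simpa using h, hz⟩
  · exact absurd h4 (ZMod.mod_four_ne_three_of_sq_eq_neg_sq' hz (eq_neg_of_add_eq_zero_left h))

/-- Descent for a binary quadratic form that is anisotropic modulo `p`. -/
theorem exists_eq_pow_mul_of_anisotropic {p : ℤ} (hp : p ≠ 0) (f : ℤ → ℤ → ℤ)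
    (hf : ∀ c y z, f (c * y) (c * z) = c ^ 2 * f y z)
    (han : ∀ y z, p ∣ f y z → p ∣ y ∧ p ∣ z) (s : ℕ) {y z : ℤ} (h : f y z = (p ^ s) ^ 2) :
    ∃ y' z', y = p ^ s * y' ∧ z = p ^ s * z' ∧ f y' z' = 1 := by
  induction s generalizing y z with
  | zero => exact ⟨y, z, by simp, by simp, by simpa using h⟩
  | succ s ih =>
    obtain ⟨⟨y, rfl⟩, ⟨z, rfl⟩⟩ := han y z ⟨p ^ s * p ^ (s + 1), by rw [h]; ring⟩
    rw [hf] at h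
    obtain ⟨y', z', rfl, rfl, h1⟩ := ih (y := y) (z := z)
      (mul_left_cancel₀ (pow_ne_zero 2 hp) (by rw [h]; ring))
    exact ⟨y', z', by ring, by ring, h1⟩

/-- The sum of the values of a function at the cubic periods in the semiprimitive case. -/
theorem exists_sign_sum_eq {p : ℕ} [hp : Fact p.Prime] (h3 : p ≡ 2 [MOD 3]) {x₀ x₁ x₂ : ℤ}
    (hm₀ : x₀ ≡ 1 [ZMOD 3]) (hm₁ : x₁ ≡ 1 [ZMOD 3]) (hm₂ : x₂ ≡ 1 [ZMOD 3])
    (hs : x₀ + x₁ + x₂ = 0) {s : ℕ} (hsq : x₀ ^ 2 + x₁ ^ 2 + x₂ ^ 2 = 6 * (p : ℤ) ^ (2 * s)) :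
    ∃ ε : ℤ, (ε = 1 ∨ ε = -1) ∧ ε * (p : ℤ) ^ s ≡ 1 [ZMOD 3] ∧
      ∀ f : ℤ → ℝ, f x₀ + f x₁ + f x₂ =
        2 * f (ε * (p : ℤ) ^ s) + f (-2 * (ε * (p : ℤ) ^ s)) := by
  obtain ⟨z, hz⟩ : (3 : ℤ) ∣ x₁ - x₂ := (hm₂.trans hm₁.symm).dvd
  -- Eliminating x₀ and x₁ = x₂ + 3z, the sum of squares is 6(x₂² + 3x₂z + 3z²), and this form
  -- becomes y² + yz + z² for y = x₂ + z.
  have hq : (x₂ + z) ^ 2 + (x₂ + z) * z + z ^ 2 = ((p : ℤ) ^ s) ^ 2 := by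
    have h0 : x₀ = -(x₁ + x₂) := by linarith
    have h1 : x₁ = x₂ + 3 * z := by linarith
    rw [← pow_mul, mul_comm s 2]
    subst h0; subst h1
    linarith
  obtain ⟨y', z', hy, hz', h1⟩ := exists_eq_pow_mul_of_anisotropic
    (by exact_mod_cast hp.out.ne_zero) (fun y z => y ^ 2 + y * z + z ^ 2)
    (fun c y z => by ring) (fun y z h => dvd_of_dvd_sq_add_mul_add_sq h3 h) s hq
  have e2 : x₂ = (p : ℤ) ^ s * (y' - z') := by linear_combination hy - hz'
  have e1 : x₁ = (p : ℤ) ^ s * (y' + 2 * z') := by linear_combination hz + hy + 2 * hz'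
  have e0 : x₀ = -((p : ℤ) ^ s * (2 * y' + z')) := by linear_combination hs - e1 - e2
  generalize (p : ℤ) ^ s = P at *
  have hz1 : z' ≤ 1 := by nlinarith [sq_nonneg (2 * y' + z')]
  have hz2 : -1 ≤ z' := by nlinarith [sq_nonneg (2 * y' + z')]
  have hy1 : y' ≤ 1 := by nlinarith [sq_nonneg (2 * z' + y')]
  have hy2 : -1 ≤ y' := by nlinarith [sq_nonneg (2 * z' + y')]
  clear hq hsq hy hz' hz hs
  subst e0; subst e1; subst e2
  have key : (∀ (ε : ℤ), ε = 1 ∨ ε = -1 → ε * P ≡ 1 [ZMOD 3] → ∀ a b c : ℤ,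
      (a = ε * P ∧ b = ε * P ∧ c = -2 * (ε * P)) ∨ (a = ε * P ∧ c = ε * P ∧ b = -2 * (ε * P)) ∨
      (b = ε * P ∧ c = ε * P ∧ a = -2 * (ε * P)) →
      ∃ ε : ℤ, (ε = 1 ∨ ε = -1) ∧ ε * P ≡ 1 [ZMOD 3] ∧ ∀ f : ℤ → ℝ, f a + f b + f c =
        2 * f (ε * P) + f (-2 * (ε * P))) := by
    rintro ε hε hP a b c h
    refine ⟨ε, hε, hP, fun f => ?_⟩
    rcases h with ⟨rfl, rfl, rfl⟩ | ⟨rfl, rfl, rfl⟩ | ⟨rfl, rfl, rfl⟩ <;> ring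
  -- The six representations of 1 all give the triple (P, P, -2P) up to order and a common sign,
  -- which the congruence modulo 3 determines.
  have hcases : (y' = 1 ∧ z' = 0) ∨ (y' = 0 ∧ z' = 1) ∨ (y' = -1 ∧ z' = 1) ∨
      (y' = -1 ∧ z' = 0) ∨ (y' = 0 ∧ z' = -1) ∨ (y' = 1 ∧ z' = -1) := by
    interval_cases y' <;> interval_cases z' <;> (revert h1; norm_num)
  unfold Int.ModEq at *
  rcases hcases with ⟨rfl, rfl⟩ | ⟨rfl, rfl⟩ | ⟨rfl, rfl⟩ | ⟨rfl, rfl⟩ | ⟨rfl, rfl⟩ | ⟨rfl, rfl⟩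
  · exact key 1 (by simp) (by omega) _ _ _ (by omega)
  · exact key (-1) (by simp) (by omega) _ _ _ (by omega)
  · exact key 1 (by simp) (by omega) _ _ _ (by omega)
  · exact key (-1) (by simp) (by omega) _ _ _ (by omega)
  · exact key 1 (by simp) (by omega) _ _ _ (by omega)
  · exact key (-1) (by simp) (by omega) _ _ _ (by omega)

/-- Two representations of a prime power by the form `a ^ 2 + N b ^ 2` with `a` prime to `p` agree
up to signs. -/
theorem sq_eq_sq_of_sq_add_mul_sq_eq {p : ℕ} [hp : Fact p.Prime] (hp2 : p ≠ 2) {t : ℕ} {M N : ℤ}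
    (hM : M ^ 2 < N) (ht : t ≠ 0) {a b a' b' : ℤ}
    (h : M * (p : ℤ) ^ t = a ^ 2 + N * b ^ 2) (h' : M * (p : ℤ) ^ t = a' ^ 2 + N * b' ^ 2)
    (ha : ¬ (p : ℤ) ∣ a) (ha' : ¬ (p : ℤ) ∣ a') :
    a ^ 2 = a' ^ 2 ∧ b ^ 2 = b' ^ 2 := by
  have hpI : Prime (p : ℤ) := Nat.prime_iff_prime_int.mp hp.out
  have hpt : (p : ℤ) ∣ (p : ℤ) ^ t := dvd_pow_self _ ht
  have hb : ¬ (p : ℤ) ∣ b := fun hb => ha (hpI.dvd_of_dvd_pow (n := 2) (by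
    rw [← dvd_add_left (Dvd.dvd.mul_left (dvd_pow hb two_ne_zero) N), ← h]
    exact Dvd.dvd.mul_left hpt _))
  have hN0 : 0 < N := lt_of_le_of_lt (sq_nonneg M) hM
  have hpp : (0 : ℤ) < (p : ℤ) ^ t := pow_pos (by exact_mod_cast hp.out.pos) _
  -- p divides at most one of the two factors, so p^t divides one of them entirely.
  have hprod : (p : ℤ) ^ t ∣ (a * b' - a' * b) * (a * b' + a' * b) :=
    ⟨M * (b' ^ 2 - b ^ 2), by linear_combination b ^ 2 * h' - b' ^ 2 * h⟩
  have hnot : ¬ ((p : ℤ) ∣ a * b' - a' * b ∧ (p : ℤ) ∣ a * b' + a' * b) := by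
    rintro ⟨h1, h2⟩
    have h3 : (p : ℤ) ∣ 2 * (a' * b) := by
      have := dvd_sub h2 h1
      rwa [show a * b' + a' * b - (a * b' - a' * b) = 2 * (a' * b) by ring] at this
    rcases hpI.dvd_or_dvd h3 with h4 | h4
    · have h5 : p ∣ 2 := by exact_mod_cast h4
      exact hp2 ((Nat.prime_dvd_prime_iff_eq hp.out Nat.prime_two).mp h5)
    · exact (hpI.dvd_or_dvd h4).elim ha' hb
  have main : ∀ c : ℤ, c ^ 2 = b' ^ 2 → (p : ℤ) ^ t ∣ a * c - a' * b → a * c = a' * b := by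
    -- By Brahmagupta's identity N(ac - a'b)² ≤ (Mp^t)². As M² < N, the multiple ac - a'b of p^t
    -- must vanish.
    rintro c hc ⟨w, hw⟩
    have hid : (a * a' + N * b * c) ^ 2 + N * (a * c - a' * b) ^ 2 =
        (M * (p : ℤ) ^ t) ^ 2 := by
      linear_combination (-(M * (p : ℤ) ^ t)) * h - (a ^ 2 + N * b ^ 2) * h' +
        (N * (a ^ 2 + N * b ^ 2)) * hc
    have hw0 : w = 0 := by
      by_contra hne
      have hw1 : 1 ≤ w ^ 2 := by
        have := sq_pos_of_ne_zero hne
        omega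
      rw [hw] at hid
      have h6 : ((p : ℤ) ^ t) ^ 2 * (M ^ 2 - N * w ^ 2) = (a * a' + N * b * c) ^ 2 := by
        linear_combination -hid
      have h7 : M ^ 2 - N * w ^ 2 < 0 := by nlinarith
      nlinarith [sq_nonneg (a * a' + N * b * c), pow_pos hpp 2]
    rw [hw0, mul_zero] at hw
    linarith
  have hfin : ∀ c : ℤ, c ^ 2 = b' ^ 2 → a * c = a' * b → a ^ 2 = a' ^ 2 ∧ b ^ 2 = b' ^ 2 := by
    intro c hc hac
    have e1 : (M * (p : ℤ) ^ t) * (b ^ 2 - b' ^ 2) = 0 := by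
      linear_combination b ^ 2 * h' - b' ^ 2 * h - (a * c + a' * b) * hac + a ^ 2 * hc
    have hM0 : M * (p : ℤ) ^ t ≠ 0 := by
      rw [h]
      have : b ^ 2 > 0 := sq_pos_of_ne_zero (fun h0 => hb (h0 ▸ dvd_zero _))
      nlinarith [sq_nonneg a]
    have e2 : b ^ 2 = b' ^ 2 := by
      have := (mul_eq_zero.mp e1).resolve_left hM0
      linarith
    exact ⟨by linear_combination h' - h - N * e2, e2⟩
  by_cases h1 : (p : ℤ) ∣ a * b' - a' * b
  · have h2 : ¬ (p : ℤ) ∣ a * b' + a' * b := fun h2 => hnot ⟨h1, h2⟩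
    have hcop : IsCoprime ((p : ℤ) ^ t) (a * b' + a' * b) :=
      IsCoprime.pow_left ((Prime.coprime_iff_not_dvd hpI).mpr h2)
    exact hfin b' rfl (main b' rfl (hcop.dvd_of_dvd_mul_right hprod))
  · have hcop : IsCoprime ((p : ℤ) ^ t) (a * b' - a' * b) :=
      IsCoprime.pow_left ((Prime.coprime_iff_not_dvd hpI).mpr h1)
    have h3 := hcop.dvd_of_dvd_mul_left hprod
    refine hfin (-b') (neg_sq _) (main (-b') (neg_sq _) ?_)
    rw [← dvd_neg]
    convert h3 using 1
    ring

/-- Write a_i = 1 + 3c_i, so that the c_i sum to -1. Three distinct residues modulo 3 would sum to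
0, so two c_i agree modulo 3 and the corresponding a_i agree modulo 9. The remaining one is u. -/
theorem exists_nine_dvd_sub {a₀ a₁ a₂ r : ℤ} (hm₀ : a₀ ≡ 1 [ZMOD 3]) (hm₁ : a₁ ≡ 1 [ZMOD 3])
    (hm₂ : a₂ ≡ 1 [ZMOD 3]) (hs : a₀ + a₁ + a₂ = 0)
    (hsq : a₀ ^ 2 + a₁ ^ 2 + a₂ ^ 2 = 6 * r) :
    ∃ u v w b : ℤ, (u = a₀ ∨ u = a₁ ∨ u = a₂) ∧ u ≡ 1 [ZMOD 3] ∧ u + v + w = 0 ∧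
      v - w = 9 * b ∧ 4 * r = u ^ 2 + 27 * b ^ 2 ∧
      ∀ f : ℤ → ℝ, f a₀ + f a₁ + f a₂ = f u + f v + f w := by
  have key : ∀ u v w : ℤ, u + v + w = 0 → u ^ 2 + v ^ 2 + w ^ 2 = 6 * r → v - w = 9 * ((v - w) / 9) →
      4 * r = u ^ 2 + 27 * ((v - w) / 9) ^ 2 := by
    intro u v w h1 h2 h3
    have h4 : u = -(v + w) := by linarith
    generalize (v - w) / 9 = b at *
    have h5 : v = w + 9 * b := by linarith
    subst h4; subst h5
    linarith
  obtain ⟨c₀, hc₀⟩ := hm₀.symm.dvd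
  obtain ⟨c₁, hc₁⟩ := hm₁.symm.dvd
  obtain ⟨c₂, hc₂⟩ := hm₂.symm.dvd
  have hcases : a₁ - a₂ = 9 * ((a₁ - a₂) / 9) ∨ a₀ - a₂ = 9 * ((a₀ - a₂) / 9) ∨
      a₀ - a₁ = 9 * ((a₀ - a₁) / 9) := by
    have h3 : ∀ c : ℤ, c % 3 = 0 ∨ c % 3 = 1 ∨ c % 3 = 2 := fun c => by omega
    rcases h3 c₀ with h0 | h0 | h0 <;> rcases h3 c₁ with h1 | h1 | h1 <;> omega
  rcases hcases with h | h | h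
  · exact ⟨a₀, a₁, a₂, _, by simp, hm₀, hs, h, key _ _ _ hs hsq h, fun f => rfl⟩
  · exact ⟨a₁, a₀, a₂, _, by simp, hm₁, by linarith, h,
      key _ _ _ (by linarith) (by linarith) h, fun f => by ring⟩
  · exact ⟨a₂, a₀, a₁, _, by simp, hm₂, by linarith, h,
      key _ _ _ (by linarith) (by linarith) h, fun f => by ring⟩

/-- The lower bound is the triangle inequality for (ra - 1) - (rv - 1) - (rw - 1) = 2ar + 1. The
upper bound is checked by signs; |b| ≥ 1 matters when all three terms are negative and the sum is 3.
-/
theorem cubic_abs_sum_bounds {a v w b r : ℝ} (hs : a + v + w = 0) (hd : v - w = 9 * b)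
    (hr : 1 ≤ r) (hb : 1 ≤ |b|) :
    |2 * a * r + 1| ≤ |r * a - 1| + |r * v - 1| + |r * w - 1| ∧
      |r * a - 1| + |r * v - 1| + |r * w - 1| ≤ 2 * (|a| * r + 1) + 9 * |b| * r := by
  have hv : v = (-a + 9 * b) / 2 := by linarith
  have hw : w = (-a - 9 * b) / 2 := by linarith
  have hra : |a| * r = |r * a| := by rw [abs_mul, abs_of_pos (by linarith : 0 < r)]; ring
  have hrb : |b| * r = |r * b| := by rw [abs_mul, abs_of_pos (by linarith : 0 < r)]; ring
  have hrb1 : 1 ≤ |r * b| := by rw [← hrb]; nlinarith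
  rw [show 2 * a * r + 1 = 2 * (r * a) + 1 by ring, mul_assoc 9, hra, hrb,
    show r * v - 1 = (-(r * a) + 9 * (r * b)) / 2 - 1 by rw [hv]; ring,
    show r * w - 1 = (-(r * a) - 9 * (r * b)) / 2 - 1 by rw [hw]; ring]
  generalize r * a = x at *
  generalize r * b = y at *
  constructor
  · have h1 := abs_sub (x - 1) ((-x + 9 * y) / 2 - 1)
    have h2 := abs_sub (x - 1 - ((-x + 9 * y) / 2 - 1)) ((-x - 9 * y) / 2 - 1)
    rw [show x - 1 - ((-x + 9 * y) / 2 - 1) - ((-x - 9 * y) / 2 - 1) = 2 * x + 1 by ring] at h2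
    linarith
  · rcases abs_cases (x - 1) with ⟨h1, _⟩ | ⟨h1, _⟩ <;>
    rcases abs_cases ((-x + 9 * y) / 2 - 1) with ⟨h2, _⟩ | ⟨h2, _⟩ <;>
    rcases abs_cases ((-x - 9 * y) / 2 - 1) with ⟨h3, _⟩ | ⟨h3, _⟩ <;>
    rw [h1, h2, h3] <;> linarith [le_abs_self x, neg_abs_le x, le_abs_self y, neg_abs_le y]

/-- For both signs of the quadratic Gauss sum the quartic periods have the same shape. -/
theorem exists_odd_even_quartic {x A B P : ℤ} (hP : P ≡ 1 [ZMOD 4]) (hx : x ^ 2 = P ^ 2)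
    (hA : x + 2 * A ≡ 1 [ZMOD 4]) (hB : -x + 2 * B ≡ 1 [ZMOD 4]) :
    ∃ C D : ℤ, (C = A ∧ D = B ∨ C = B ∧ D = A) ∧ Odd C ∧ Even D ∧
      |(x : ℝ) + 2 * A - 1| + |(x : ℝ) - 2 * A - 1| + |-(x : ℝ) + 2 * B - 1| +
        |-(x : ℝ) - 2 * B - 1| =
      |-(P : ℝ) + 2 * C - 1| + |-(P : ℝ) - 2 * C - 1| + |(P : ℝ) + 2 * D - 1| +
        |(P : ℝ) - 2 * D - 1| := by
  unfold Int.ModEq at *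
  -- Modulo 4, x = P forces A even and B odd, and x = -P the opposite.
  rcases sq_eq_sq_iff_eq_or_eq_neg.mp hx with rfl | rfl
  · exact ⟨B, A, by simp, by rw [Int.odd_iff]; omega, by rw [Int.even_iff]; omega, by ring⟩
  · exact ⟨A, B, by simp, by rw [Int.odd_iff]; omega, by rw [Int.even_iff]; omega, by
      rw [Int.cast_neg, neg_neg]⟩

/-- For the lower bound, take the first two terms with sign - and the last two with sign +: C, D and
the constants cancel and 4P remains. -/
theorem quartic_abs_sum_bounds {P C D : ℝ} (hP : 1 ≤ P) :
    4 * P ≤ |-P + 2 * C - 1| + |-P - 2 * C - 1| + |P + 2 * D - 1| + |P - 2 * D - 1| ∧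
      |-P + 2 * C - 1| + |-P - 2 * C - 1| + |P + 2 * D - 1| + |P - 2 * D - 1| ≤
        4 * P + 4 * |C| + 4 * |D| := by
  have e1 := neg_abs_le (-P + 2 * C - 1)
  have e2 := neg_abs_le (-P - 2 * C - 1)
  have e3 := le_abs_self (P + 2 * D - 1)
  have e4 := le_abs_self (P - 2 * D - 1)
  refine ⟨by linarith, ?_⟩
  have u1 : |-P + 2 * C - 1| ≤ P + 1 + 2 * |C| :=
    abs_le.mpr ⟨by linarith [neg_abs_le C], by linarith [le_abs_self C]⟩
  have u2 : |-P - 2 * C - 1| ≤ P + 1 + 2 * |C| :=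
    abs_le.mpr ⟨by linarith [le_abs_self C], by linarith [neg_abs_le C]⟩
  have u3 : |P + 2 * D - 1| ≤ P - 1 + 2 * |D| :=
    abs_le.mpr ⟨by linarith [neg_abs_le D], by linarith [le_abs_self D]⟩
  have u4 : |P - 2 * D - 1| ≤ P - 1 + 2 * |D| :=
    abs_le.mpr ⟨by linarith [le_abs_self D], by linarith [neg_abs_le D]⟩
  linarith

/-- The sum of the absolute values of the quartic periods in the semiprimitive case. -/
theorem quartic_abs_sum_eq {p : ℕ} [hp : Fact p.Prime] (h4 : p ≡ 3 [MOD 4]) {x A B : ℤ}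
    (hA : x + 2 * A ≡ 1 [ZMOD 4]) (hB : -x + 2 * B ≡ 1 [ZMOD 4]) {s : ℕ}
    (hAB : A ^ 2 + B ^ 2 = (p : ℤ) ^ (2 * s)) (hx : x ^ 2 = (p : ℤ) ^ (2 * s)) :
    ((p : ℤ) ^ s ≡ 1 [ZMOD 4] →
      |(x : ℝ) + 2 * A - 1| + |(x : ℝ) - 2 * A - 1| + |-(x : ℝ) + 2 * B - 1| +
        |-(x : ℝ) - 2 * B - 1| = 6 * (p : ℝ) ^ s - 2) ∧
    ((p : ℤ) ^ s ≡ 3 [ZMOD 4] →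
      |(x : ℝ) + 2 * A - 1| + |(x : ℝ) - 2 * A - 1| + |-(x : ℝ) + 2 * B - 1| +
        |-(x : ℝ) - 2 * B - 1| = 6 * (p : ℝ) ^ s + 2) := by
  rw [mul_comm 2 s, pow_mul] at hAB hx
  obtain ⟨A', B', hA', hB', h1⟩ := exists_eq_pow_mul_of_anisotropic
    (by exact_mod_cast hp.out.ne_zero) (fun y z => y ^ 2 + z ^ 2)
    (fun c y z => by ring) (fun y z h => dvd_of_dvd_sq_add_sq h4 h) s hAB
  have hPR : (p : ℝ) ^ s = (((p : ℤ) ^ s : ℤ) : ℝ) := by push_cast; rfl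
  have hP1 : (1 : ℤ) ≤ (p : ℤ) ^ s := one_le_pow₀ (by exact_mod_cast hp.out.one_lt.le)
  rw [hPR]
  generalize (p : ℤ) ^ s = P at *
  have hPr : (1 : ℝ) ≤ P := by exact_mod_cast hP1
  have a1 : |(P : ℝ) - 1| = P - 1 := abs_of_nonneg (by linarith)
  have a2 : |-(P : ℝ) - 1| = P + 1 := by rw [abs_of_nonpos (by linarith)]; ring
  have a3 : |3 * (P : ℝ) - 1| = 3 * P - 1 := abs_of_nonneg (by linarith)
  have a4 : |-3 * (P : ℝ) - 1| = 3 * P + 1 := by rw [abs_of_nonpos (by linarith)]; ring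
  -- Only the four representations of 1 as a sum of two squares occur; with the sign of x, the
  -- congruences modulo 4 rule out all but the stated values.
  have hcases : (A' = 1 ∧ B' = 0) ∨ (A' = -1 ∧ B' = 0) ∨ (A' = 0 ∧ B' = 1) ∨
      (A' = 0 ∧ B' = -1) := by
    have h2 : A' ≤ 1 := by nlinarith [sq_nonneg B']
    have h3 : -1 ≤ A' := by nlinarith [sq_nonneg B']
    have h4 : B' ≤ 1 := by nlinarith [sq_nonneg A']
    have h5 : -1 ≤ B' := by nlinarith [sq_nonneg A']
    interval_cases A' <;> interval_cases B' <;> (revert h1; norm_num)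
  clear hAB h1
  subst hA' hB'
  unfold Int.ModEq at *
  have n1 : (P : ℝ) + 2 * P - 1 = 3 * P - 1 := by ring
  have n2 : (P : ℝ) - 2 * P - 1 = -P - 1 := by ring
  have n3 : -(P : ℝ) + 2 * P - 1 = P - 1 := by ring
  have n4 : -(P : ℝ) - 2 * P - 1 = -3 * P - 1 := by ring
  have n5 : (P : ℝ) + -(2 * P) - 1 = -P - 1 := by ring
  have n6 : -(P : ℝ) + -(2 * P) - 1 = -3 * P - 1 := by ring
  have hx' := sq_eq_sq_iff_eq_or_eq_neg.mp hx
  constructor <;> intro hP <;> rcases hx' with rfl | rfl <;>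
    rcases hcases with ⟨rfl, rfl⟩ | ⟨rfl, rfl⟩ | ⟨rfl, rfl⟩ | ⟨rfl, rfl⟩ <;>
    first
    | (exfalso; omega)
    | (push_cast
       simp only [mul_one, mul_zero, mul_neg, add_zero, sub_zero, neg_neg, sub_neg_eq_add,
         n1, n2, n3, n4, n5, n6, a1, a2, a3, a4]
       ring)

end Arithmetic

/-! ### Energies in the two cases and the theorem -/

section Main

theorem exists_eq_mul_add_one_of_dvd {p m k : ℕ} (hp : p.Prime) (hm : m ≠ 0)
    (h : k ∣ (p ^ m - 1) / (p - 1)) :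
    ∃ n, p ^ m = k * n + 1 ∧ 0 < n ∧ p - 1 ∣ n := by
  obtain ⟨c, hc⟩ := h
  have hd : p - 1 ∣ p ^ m - 1 := by simpa using Nat.sub_dvd_pow_sub_pow p 1 m
  have h1 : p ^ m - 1 = (p - 1) * (k * c) := by rw [← hc, Nat.mul_div_cancel' hd]
  have h2 : 1 < p ^ m := Nat.one_lt_pow hm hp.one_lt
  refine ⟨(p - 1) * c, ?_, ?_, dvd_mul_right _ _⟩
  · have : k * ((p - 1) * c) = (p - 1) * (k * c) := by ring
    omega
  · rcases Nat.eq_zero_or_pos ((p - 1) * c) with h0 | h0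
    · have : (p - 1) * (k * c) = k * ((p - 1) * c) := by ring
      rw [h0, mul_zero] at this
      omega
    · exact h0

/-- (p^m - 1)/(p - 1) is a sum of m powers of p, each ≡ 1 (mod k). -/
theorem dvd_of_dvd_geom_sum {p m k : ℕ} (hp : p.Prime) (h : k ∣ (p ^ m - 1) / (p - 1))
    (hpk : p ≡ 1 [MOD k]) : k ∣ m := by
  rw [← Nat.geomSum_eq hp.two_le, ← ZMod.natCast_eq_zero_iff] at h
  have h1 : (p : ZMod k) = 1 := by simpa using (ZMod.natCast_eq_natCast_iff p 1 k).mpr hpk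
  push_cast at h
  simp only [h1, one_pow, Finset.sum_const, Finset.card_range, nsmul_eq_mul, mul_one] at h
  exact (ZMod.natCast_eq_zero_iff m k).mp h

/-- For odd m, 1 ≡ p^m ≡ -1 (mod k) would give k ∣ 2. -/
theorem even_of_pow_eq_mul_add_one {p m k n : ℕ} (hk : 3 ≤ k) (h : p ^ m = k * n + 1)
    (hpk : p ≡ k - 1 [MOD k]) : Even m := by
  by_contra hm
  rw [Nat.not_even_iff_odd] at hm
  have h1 : (p : ZMod k) = -1 := by
    rw [(ZMod.natCast_eq_natCast_iff p (k - 1) k).mpr hpk, Nat.cast_sub (by omega)]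
    simp
  have h2 : ((p ^ m : ℕ) : ZMod k) = ((k * n + 1 : ℕ) : ZMod k) := by rw [h]
  push_cast at h2
  rw [h1, hm.neg_one_pow, ZMod.natCast_self, zero_mul, zero_add] at h2
  have h3 : ((2 : ℕ) : ZMod k) = 0 := by push_cast; linear_combination -h2
  rw [ZMod.natCast_eq_zero_iff] at h3
  exact absurd (Nat.le_of_dvd (by norm_num) h3) (by omega)

theorem natCast_pow_mul_rpow_one_div (p t : ℕ) {k : ℕ} (hk : k ≠ 0) :
    ((p ^ (k * t) : ℕ) : ℝ) ^ (1 / (k : ℝ)) = (p : ℝ) ^ t := by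
  rw [mul_comm, pow_mul, Nat.cast_pow, one_div, Real.pow_rpow_inv_natCast (by positivity) hk,
    Nat.cast_pow]

theorem sqrt_natCast_pow_two_mul (p s : ℕ) : √((p ^ (2 * s) : ℕ) : ℝ) = (p : ℝ) ^ s := by
  rw [mul_comm, pow_mul, Nat.cast_pow, Real.sqrt_sq (by positivity), Nat.cast_pow]

theorem isCoprime_natCast_iff {p : ℕ} (hp : p.Prime) {a : ℤ} :
    IsCoprime a (p : ℤ) ↔ ¬ (p : ℤ) ∣ a := by
  rw [isCoprime_comm, Prime.coprime_iff_not_dvd (Nat.prime_iff_prime_int.mp hp)]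

variable {F : Type*} [Field F] [Fintype F] {p : ℕ}

theorem cubic_energy_bounds [hp : Fact p.Prime] [CharP F p] {t n : ℕ} (ht : t ≠ 0)
    (hq : Fintype.card F = p ^ (3 * t)) (hkn : Fintype.card F = 3 * n + 1) (hn : 0 < n)
    (hpn : p - 1 ∣ n) (hp3 : p ≡ 1 [MOD 3]) :
    (∃ a b : ℤ, IsCubicPair p (p ^ (3 * t)) a b) ∧
      ∀ a b : ℤ, IsCubicPair p (p ^ (3 * t)) a b →
        n * (1 + 1 / 3 * |2 * (a : ℝ) * (p : ℝ) ^ t + 1|) ≤ graphEnergy (gpGraph 3 F) ∧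
        graphEnergy (gpGraph 3 F) ≤ n * (1 + 2 / 3 * (|(a : ℝ)| * (p : ℝ) ^ t + 1)
          + 3 * |(b : ℝ)| * (p : ℝ) ^ t) := by
  have hcubic : ∀ a b : ℤ, IsCubicPair p (p ^ (3 * t)) a b ↔
      4 * (p : ℤ) ^ t = a ^ 2 + 27 * b ^ 2 ∧ a ≡ 1 [ZMOD 3] ∧ ¬ (p : ℤ) ∣ a := by
    intro a b
    have h := natCast_pow_mul_rpow_one_div p t (k := 3) (by norm_num)
    push_cast at h
    rw [IsCubicPair, isCoprime_natCast_iff hp.out]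
    push_cast
    rw [h]
    refine and_congr_left fun _ => ?_
    norm_cast
  simp only [hcubic]
  obtain ⟨x, hE, hx1, hx0, hxsq, hdiv⟩ := exists_cubic_periods hq hkn hn hpn
  have hpt : (p : ℤ) ∣ (p : ℤ) ^ t := dvd_pow_self _ ht
  choose a ha hpa using hdiv hp3 ((p : ℤ) ^ t) (by ring) hpt
  have hr0 : (p : ℤ) ^ t ≠ 0 := pow_ne_zero _ (by exact_mod_cast hp.out.ne_zero)
  have hr1 : (p : ℤ) ^ t ≡ 1 [ZMOD 3] := by
    have : (p : ℤ) ≡ 1 [ZMOD 3] := by exact_mod_cast (Int.natCast_modEq_iff (n := 3)).mpr hp3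
    simpa using this.pow t
  have ha1 : ∀ i, a i ≡ 1 [ZMOD 3] := fun i => by
    have h := hr1.mul_right (a i)
    rw [← ha, one_mul] at h
    exact h.symm.trans (hx1 i)
  have hs : a 0 + a 1 + a 2 = 0 := by
    refine mul_left_cancel₀ hr0 ?_
    rw [mul_add, mul_add, ← ha, ← ha, ← ha, hx0, mul_zero]
  have hsq : a 0 ^ 2 + a 1 ^ 2 + a 2 ^ 2 = 6 * (p : ℤ) ^ t := by
    refine mul_left_cancel₀ (pow_ne_zero 2 hr0) ?_
    rw [ha, ha, ha] at hxsq
    linear_combination hxsq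
  obtain ⟨u, v, w, b, hu, hu1, huvw, hvw, hub, hf⟩ :=
    exists_nine_dvd_sub (ha1 0) (ha1 1) (ha1 2) hs hsq
  have hpu : ¬ (p : ℤ) ∣ u := by rcases hu with rfl | rfl | rfl <;> exact hpa _
  have hp2 : p ≠ 2 := by rintro rfl; exact absurd hp3 (by decide)
  refine ⟨⟨u, b, hub, hu1, hpu⟩, fun u' b' ⟨hub', hu1', hpu'⟩ => ?_⟩
  obtain ⟨h1, h2⟩ := sq_eq_sq_of_sq_add_mul_sq_eq hp2 (by norm_num) ht hub' hub hpu' hpu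
  -- a ≡ 1 (mod 3) fixes the sign of a; b enters only through |b|.
  have hu' : u' = u := by
    rcases sq_eq_sq_iff_eq_or_eq_neg.mp h1 with h | h
    · exact h
    · unfold Int.ModEq at *; omega
  have hb' : |(b' : ℝ)| = |(b : ℝ)| := sq_eq_sq_iff_abs_eq_abs _ _ |>.mp (by exact_mod_cast h2)
  subst hu'
  rw [hb']
  have hb1 : 1 ≤ |(b : ℝ)| := by
    rw [← Int.cast_abs]
    -- With b = 0, p would divide u'² = 4p^t.
    have : b ≠ 0 := by
      rintro rfl
      refine hpu ((Nat.prime_iff_prime_int.mp hp.out).dvd_of_dvd_pow (n := 2) ?_)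
      rw [show u' ^ 2 = 4 * (p : ℤ) ^ t by linarith]
      exact Dvd.dvd.mul_left hpt _
    exact_mod_cast Int.one_le_abs this
  have hr : (1 : ℝ) ≤ (p : ℝ) ^ t := one_le_pow₀ (by exact_mod_cast hp.out.one_lt.le)
  obtain ⟨hl, hr⟩ := cubic_abs_sum_bounds (a := u') (v := v) (w := w) (b := b)
    (r := (p : ℝ) ^ t) (by exact_mod_cast huvw) (by exact_mod_cast hvw) hr hb1
  have hsum := hf fun z => |(p : ℝ) ^ t * (z : ℝ) - 1|
  have hE' : graphEnergy (gpGraph 3 F) = n + n / 3 * (|(p : ℝ) ^ t * (u' : ℝ) - 1| +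
      |(p : ℝ) ^ t * (v : ℝ) - 1| + |(p : ℝ) ^ t * (w : ℝ) - 1|) := by
    rw [hE, ← hsum, ha, ha, ha]
    push_cast
    rfl
  have hn0 : (0 : ℝ) < n := by exact_mod_cast hn
  rw [hE']
  constructor
  · have := mul_le_mul_of_nonneg_left hl (by positivity : (0 : ℝ) ≤ n / 3)
    linarith
  · have := mul_le_mul_of_nonneg_left hr (by positivity : (0 : ℝ) ≤ n / 3)
    linarith

theorem quartic_energy_bounds [hp : Fact p.Prime] [CharP F p] {t n : ℕ} (ht : t ≠ 0)
    (hq : Fintype.card F = p ^ (4 * t)) (hkn : Fintype.card F = 4 * n + 1) (hn : 0 < n)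
    (hpn : p - 1 ∣ n) (hp4 : p ≡ 1 [MOD 4]) :
    (∃ c d : ℤ, IsQuarticPair p (p ^ (4 * t)) c d) ∧
      ∀ c d : ℤ, IsQuarticPair p (p ^ (4 * t)) c d →
        n * ((p : ℝ) ^ (2 * t) + 1) ≤ graphEnergy (gpGraph 4 F) ∧
        graphEnergy (gpGraph 4 F) ≤
          n * ((p : ℝ) ^ (2 * t) + 1 + (|(c : ℝ)| + 2 * |(d : ℝ)|) * (p : ℝ) ^ t) := by
  have hquartic : ∀ c d : ℤ, IsQuarticPair p (p ^ (4 * t)) c d ↔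
      (p : ℤ) ^ (2 * t) = c ^ 2 + 4 * d ^ 2 ∧ c ≡ 1 [ZMOD 4] ∧ ¬ (p : ℤ) ∣ c := by
    intro c d
    rw [IsQuarticPair, isCoprime_natCast_iff hp.out, show 4 * t = 2 * (2 * t) by ring,
      sqrt_natCast_pow_two_mul]
    refine and_congr_left fun _ => ?_
    norm_cast
  simp only [hquartic]
  obtain ⟨x, A, B, hE, hA, hB, hAB, hx, hdiv⟩ := exists_quartic_periods hq hkn hn hpn
  have hpt : (p : ℤ) ∣ (p : ℤ) ^ t := dvd_pow_self _ ht
  have hp1 : (p : ℤ) ≡ 1 [ZMOD 4] := by exact_mod_cast (Int.natCast_modEq_iff (n := 4)).mpr hp4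
  have hpodd : Odd (p : ℤ) := by rw [Int.odd_iff]; unfold Int.ModEq at hp1; omega
  obtain ⟨s, s', hs, hs', hss, hps, hps'⟩ := hdiv hp4 ((p : ℤ) ^ t) (by ring) hpt hpodd.pow
  obtain ⟨C, D, hCD, hC, hD, hsum⟩ := exists_odd_even_quartic (P := (p : ℤ) ^ (2 * t))
    (by simpa using hp1.pow (2 * t)) (by rw [hx]; ring) hA hB
  obtain ⟨c, d, hc, hd, hcd, hpc⟩ : ∃ c d : ℤ, C = (p : ℤ) ^ t * c ∧ D = (p : ℤ) ^ t * d ∧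
      c ^ 2 + d ^ 2 = ((p : ℤ) ^ t) ^ 2 ∧ ¬ (p : ℤ) ∣ c := by
    rcases hCD with ⟨rfl, rfl⟩ | ⟨rfl, rfl⟩
    · exact ⟨s, s', hs, hs', hss, hps⟩
    · exact ⟨s', s, hs', hs, by rw [add_comm, hss], hps'⟩
  have hcodd : Odd c := (Int.odd_mul.mp (hc ▸ hC)).2
  -- D is even and p^t odd, so d is even; this is where the coefficient 4 in c² + 4d² comes from.
  obtain ⟨e, rfl⟩ : ∃ e, d = 2 * e := by
    rcases Int.even_mul.mp (hd ▸ hD) with h | h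
    · exact absurd (hpodd.pow (n := t)) (Int.not_odd_iff_even.mpr h)
    · obtain ⟨e, he⟩ := h
      exact ⟨e, by rw [he]; ring⟩
  have hce : (p : ℤ) ^ (2 * t) = c ^ 2 + 4 * e ^ 2 := by rw [mul_comm 2 t, pow_mul, ← hcd]; ring
  have hp2 : p ≠ 2 := by rintro rfl; exact absurd hp4 (by decide)
  constructor
  · rw [Int.odd_iff] at hcodd
    obtain h | h : c % 4 = 1 ∨ c % 4 = 3 := by omega
    · exact ⟨c, e, hce, h, hpc⟩
    · exact ⟨-c, e, by rw [neg_sq, hce], by unfold Int.ModEq; omega, by rwa [dvd_neg]⟩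
  · rintro c' d' ⟨h1, -, hpc'⟩
    obtain ⟨h2, h3⟩ := sq_eq_sq_of_sq_add_mul_sq_eq hp2 (M := 1) (N := 4) (by norm_num)
      (mul_ne_zero two_ne_zero ht) (by rw [one_mul, h1]) (by rw [one_mul, hce]) hpc' hpc
    have h2' : |(c' : ℝ)| = |(c : ℝ)| := sq_eq_sq_iff_abs_eq_abs _ _ |>.mp (by exact_mod_cast h2)
    have h3' : |(d' : ℝ)| = |(e : ℝ)| := sq_eq_sq_iff_abs_eq_abs _ _ |>.mp (by exact_mod_cast h3)
    have hP1 : (1 : ℝ) ≤ (p : ℝ) ^ (2 * t) := one_le_pow₀ (by exact_mod_cast hp.out.one_lt.le)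
    obtain ⟨hl, hr⟩ := quartic_abs_sum_bounds (C := C) (D := D) hP1
    push_cast at hsum
    rw [hE, hsum, h2', h3']
    have hCr : |(C : ℝ)| = (p : ℝ) ^ t * |(c : ℝ)| := by
      rw [hc]; push_cast; rw [abs_mul, abs_of_nonneg (by positivity : (0 : ℝ) ≤ (p : ℝ) ^ t)]
    have hDr : |(D : ℝ)| = (p : ℝ) ^ t * (2 * |(e : ℝ)|) := by
      rw [hd]; push_cast
      rw [abs_mul, abs_mul, abs_of_nonneg (by positivity : (0 : ℝ) ≤ (p : ℝ) ^ t), abs_two]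
    rw [hCr, hDr] at hr
    constructor
    · have := mul_le_mul_of_nonneg_left hl (by positivity : (0 : ℝ) ≤ n / 4)
      linarith
    · have := mul_le_mul_of_nonneg_left hr (by positivity : (0 : ℝ) ≤ n / 4)
      linarith

/-- Since p ≡ -1 (mod 3), the condition εp^s ≡ 1 (mod 3) reads ε = (-1)^s, so the parity of s
decides the signs. -/
theorem cubic_energy_semiprimitive [hp : Fact p.Prime] [CharP F p] {s n : ℕ}
    (hq : Fintype.card F = p ^ (2 * s)) (hkn : Fintype.card F = 3 * n + 1) (hn : 0 < n)
    (hpn : p - 1 ∣ n) (hp3 : p ≡ 2 [MOD 3]) :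
    (Even s → graphEnergy (gpGraph 3 F) = 2 * n * ((2 * (p : ℝ) ^ s + 1) / 3)) ∧
      (Odd s → graphEnergy (gpGraph 3 F) = 4 * n * (((p : ℝ) ^ s + 1) / 3)) := by
  obtain ⟨x, hE, hx1, hx0, hxsq, -⟩ := exists_cubic_periods hq hkn hn hpn
  obtain ⟨ε, hε, hεP, hf⟩ := exists_sign_sum_eq hp3 (hx1 0) (hx1 1) (hx1 2) hx0 hxsq
  have hsum := hf fun z => |(z : ℝ) - 1|
  rw [hE, hsum]
  have hp1 : (p : ℤ) ≡ -1 [ZMOD 3] := by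
    have : (p : ℤ) ≡ 2 [ZMOD 3] := by exact_mod_cast (Int.natCast_modEq_iff (n := 3)).mpr hp3
    exact this.trans (by decide)
  have hps := hp1.pow s
  have hP1 : (1 : ℝ) ≤ (p : ℝ) ^ s := one_le_pow₀ (by exact_mod_cast hp.out.one_lt.le)
  push_cast
  constructor
  · intro hs
    rw [hs.neg_one_pow] at hps
    obtain rfl : ε = 1 := by
      rcases hε with h | h
      · exact h
      · subst h; unfold Int.ModEq at *; omega
    push_cast
    rw [one_mul, abs_of_nonneg (by linarith), abs_of_nonpos (by linarith)]
    ring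
  · intro hs
    rw [hs.neg_one_pow] at hps
    obtain rfl : ε = -1 := by
      rcases hε with h | h
      · subst h; unfold Int.ModEq at *; omega
      · exact h
    push_cast
    rw [abs_of_nonpos (by linarith), abs_of_nonneg (by linarith)]
    ring

theorem quartic_energy_semiprimitive [hp : Fact p.Prime] [CharP F p] {s n : ℕ}
    (hq : Fintype.card F = p ^ (2 * s)) (hkn : Fintype.card F = 4 * n + 1) (hn : 0 < n)
    (hpn : p - 1 ∣ n) (hp4 : p ≡ 3 [MOD 4]) :
    (Even s → graphEnergy (gpGraph 4 F) = n * ((3 * (p : ℝ) ^ s + 1) / 2)) ∧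
      (Odd s → graphEnergy (gpGraph 4 F) = 3 * n * (((p : ℝ) ^ s + 1) / 2)) := by
  obtain ⟨x, A, B, hE, hA, hB, hAB, hx, -⟩ := exists_quartic_periods hq hkn hn hpn
  obtain ⟨h1, h3⟩ := quartic_abs_sum_eq hp4 hA hB hAB hx
  have hp1 : (p : ℤ) ≡ -1 [ZMOD 4] := by
    have : (p : ℤ) ≡ 3 [ZMOD 4] := by exact_mod_cast (Int.natCast_modEq_iff (n := 4)).mpr hp4
    exact this.trans (by decide)
  have hps := hp1.pow s
  rw [hE]
  constructor
  · intro hs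
    rw [hs.neg_one_pow] at hps
    rw [h1 hps]
    ring
  · intro hs
    rw [hs.neg_one_pow] at hps
    rw [h3 (hps.trans (by decide))]
    ring

end Main

theorem proposition4p1 (p m q : ℕ) (hp : p.Prime) (hq : q = p ^ m)
    (F : Type*) [Field F] [Fintype F] (hF : Fintype.card F = q) :
    -- the case `k = 3`, with `n = (q - 1) / 3`
    (3 ∣ (q - 1) / (p - 1) → ∀ n : ℝ, n = ((q : ℝ) - 1) / 3 →
      (p ≡ 1 [MOD 3] →
        (∃ a b : ℤ, IsCubicPair p q a b) ∧
        ∀ a b : ℤ, IsCubicPair p q a b →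
          ∀ Γ ∈ ({gpGraph 3 F, gpSumGraph 3 F} : Set (Digraph F)),
            n * (1 + 1 / 3 * |2 * (a : ℝ) * (q : ℝ) ^ (1 / 3 : ℝ) + 1|) ≤ graphEnergy Γ ∧
            graphEnergy Γ ≤ n * (1 + 2 / 3 * (|(a : ℝ)| * (q : ℝ) ^ (1 / 3 : ℝ) + 1)
              + 3 * |(b : ℝ)| * (q : ℝ) ^ (1 / 3 : ℝ))) ∧
      (p ≡ 2 [MOD 3] →
        (m ≡ 0 [MOD 4] ∨ m ≡ 2 [MOD 4]) ∧
        ∀ Γ ∈ ({gpGraph 3 F, gpSumGraph 3 F} : Set (Digraph F)),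
          (m ≡ 0 [MOD 4] → graphEnergy Γ = 2 * n * ((2 * √(q : ℝ) + 1) / 3)) ∧
          (m ≡ 2 [MOD 4] → graphEnergy Γ = 4 * n * ((√(q : ℝ) + 1) / 3)))) ∧
    -- the case `k = 4`, with `n = (q - 1) / 4`
    (4 ∣ (q - 1) / (p - 1) → ∀ n : ℝ, n = ((q : ℝ) - 1) / 4 →
      (p ≡ 1 [MOD 4] →
        (∃ c d : ℤ, IsQuarticPair p q c d) ∧
        ∀ c d : ℤ, IsQuarticPair p q c d →
          ∀ Γ ∈ ({gpGraph 4 F, gpSumGraph 4 F} : Set (Digraph F)),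
            n * (√(q : ℝ) + 1) ≤ graphEnergy Γ ∧
            graphEnergy Γ ≤ n * (√(q : ℝ) + 1
              + (|(c : ℝ)| + 2 * |(d : ℝ)|) * (q : ℝ) ^ (1 / 4 : ℝ))) ∧
      (p ≡ 3 [MOD 4] →
        (m ≡ 0 [MOD 4] ∨ m ≡ 2 [MOD 4]) ∧
        ∀ Γ ∈ ({gpGraph 4 F, gpSumGraph 4 F} : Set (Digraph F)),
          (m ≡ 0 [MOD 4] → graphEnergy Γ = n * ((3 * √(q : ℝ) + 1) / 2)) ∧
          (m ≡ 2 [MOD 4] → graphEnergy Γ = 3 * n * ((√(q : ℝ) + 1) / 2)))) := by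
  have := Fact.mk hp
  subst hq
  have hm : m ≠ 0 := by
    rintro rfl
    exact absurd Fintype.one_lt_card (by rw [hF, pow_zero]; exact lt_irrefl 1)
  have hchar : CharP F p := charP_of_card_eq_prime_pow hF
  have energy_eq : ∀ {k n : ℕ}, p ^ m = k * n + 1 → 0 < n → p - 1 ∣ n →
      ∀ Γ ∈ ({gpGraph k F, gpSumGraph k F} : Set (Digraph F)),
        graphEnergy Γ = graphEnergy (gpGraph k F) := by
    rintro k n hkn hn hpn Γ (rfl | rfl)
    · rfl
    · exact graphEnergy_gpSumGraph (hF.trans hkn) hn hpn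
  have hcast : ∀ {k n' : ℕ} {n : ℝ}, k ≠ 0 → p ^ m = k * n' + 1 →
      n = (((p ^ m : ℕ) : ℝ) - 1) / k → n = n' := by
    intro k n' n hk h hn
    have hk' : (k : ℝ) ≠ 0 := by exact_mod_cast hk
    rw [hn, h]
    push_cast
    field_simp
    ring
  refine ⟨fun hdvd n hn => ?_, fun hdvd n hn => ?_⟩
  · obtain ⟨n', hkn, hn', hpn⟩ := exists_eq_mul_add_one_of_dvd hp hm hdvd
    obtain rfl : n = n' := hcast (k := 3) (by norm_num) hkn (by exact_mod_cast hn)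
    refine ⟨fun hp3 => ?_, fun hp3 => ?_⟩
    · obtain ⟨t, rfl⟩ := dvd_of_dvd_geom_sum hp hdvd hp3
      obtain ⟨hex, hbound⟩ := cubic_energy_bounds (by omega) hF (hF.trans hkn) hn' hpn hp3
      refine ⟨hex, fun a b hab Γ hΓ => ?_⟩
      have hr := natCast_pow_mul_rpow_one_div p t (k := 3) (by norm_num)
      rw [Nat.cast_ofNat] at hr
      rw [energy_eq hkn hn' hpn Γ hΓ, hr]
      exact hbound a b hab
    · obtain ⟨s, rfl⟩ := (even_of_pow_eq_mul_add_one le_rfl hkn hp3).two_dvd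
      obtain ⟨he, ho⟩ := cubic_energy_semiprimitive hF (hF.trans hkn) hn' hpn hp3
      unfold Nat.ModEq
      refine ⟨by omega, fun Γ hΓ => ?_⟩
      rw [energy_eq hkn hn' hpn Γ hΓ, sqrt_natCast_pow_two_mul]
      exact ⟨fun h => he (Nat.even_iff.mpr (by omega)), fun h => ho (Nat.odd_iff.mpr (by omega))⟩
  · obtain ⟨n', hkn, hn', hpn⟩ := exists_eq_mul_add_one_of_dvd hp hm hdvd
    obtain rfl : n = n' := hcast (k := 4) (by norm_num) hkn (by exact_mod_cast hn)
    refine ⟨fun hp4 => ?_, fun hp4 => ?_⟩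
    · obtain ⟨t, rfl⟩ := dvd_of_dvd_geom_sum hp hdvd hp4
      obtain ⟨hex, hbound⟩ := quartic_energy_bounds (by omega) hF (hF.trans hkn) hn' hpn hp4
      refine ⟨hex, fun c d hcd Γ hΓ => ?_⟩
      have hr := natCast_pow_mul_rpow_one_div p t (k := 4) (by norm_num)
      have hs := sqrt_natCast_pow_two_mul p (2 * t)
      rw [Nat.cast_ofNat] at hr
      rw [show 2 * (2 * t) = 4 * t by ring] at hs
      rw [energy_eq hkn hn' hpn Γ hΓ, hr, hs]
      exact hbound c d hcd
    · obtain ⟨s, rfl⟩ := (even_of_pow_eq_mul_add_one (by norm_num) hkn hp4).two_dvd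
      obtain ⟨he, ho⟩ := quartic_energy_semiprimitive hF (hF.trans hkn) hn' hpn hp4
      unfold Nat.ModEq
      refine ⟨by omega, fun Γ hΓ => ?_⟩
      rw [energy_eq hkn hn' hpn Γ hΓ, sqrt_natCast_pow_two_mul]
      exact ⟨fun h => he (Nat.even_iff.mpr (by omega)), fun h => ho (Nat.odd_iff.mpr (by omega))⟩
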